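/- The number of linear extensions of a two-dimensional poset on $n$ elements can be computed exactly in time $O(1.8172^n)$. That is, there is a single program (for a deterministic random access machine on natural numbers with logarithmic cost, in which every elementary operation is charged in terms of the binary lengths of its operands and addresses) such that, for every $n$ and every poset $\mathcal{P}=(X,\prec)$ with $X=\{0,\dots,n-1\}$ and $\dim(\mathcal{P})\le 2$, given as input $n$ and the $n\times n$ zero-one matrix of the relation $\prec$, the program halts within time $T(n)$ and outputs the number of total orders on $X$ that contain $\prec$, where $T(n)=O(1.8172^n)$. Here $\prec$ is irreflexive and transitive, and $\dim(\mathcal{P})$ is the least number $d$ of total orders on $X$ whose intersection is $\prec$. -/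

import Mathlib

open Filter Asymptotics

/-! ### Finite posets, linear extensions, dimension

A poset is a ground set with an irreflexive and transitive relation `r` (`IsStrictOrder`). -/

/-- `L` is a linear extension of `r`: a (strict) total order containing `r`. -/
def IsLinearExtension {X : Type*} (r L : X → X → Prop) : Prop :=
  IsStrictTotalOrder X L ∧ ∀ x y, r x y → L x y

/-- The number of linear extensions of `r`. -/
noncomputable def numLinearExtensions {X : Type*} (r : X → X → Prop) : ℕ :=
  Nat.card {L : X → X → Prop // IsLinearExtension r L}

/-- The total orders `L 0, …, L (d - 1)` are realizers of `r`: their intersection is `r`. -/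
def IsRealizer {X : Type*} (r : X → X → Prop) {d : ℕ} (L : Fin d → X → X → Prop) : Prop :=
  (∀ k, IsStrictTotalOrder X (L k)) ∧ ∀ x y, r x y ↔ ∀ k, L k x y

/-- The dimension of a poset: the least number of total orders whose intersection is the poset. -/
noncomputable def posetDim {X : Type*} (r : X → X → Prop) : ℕ∞ :=
  ⨅ (d : ℕ) (_ : ∃ L : Fin d → X → X → Prop, IsRealizer r L), (d : ℕ∞)

/-! ### Random access machines with logarithmic cost

Programs are while-programs over finitely many natural-number variables and finitely many
arrays of natural numbers, indexed by natural numbers.  Every elementary operation is charged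
one unit plus the binary lengths of the numbers (and of the array indices) it handles;
multiplication and division are charged the product of the binary lengths. -/

namespace RAM

/-- The arithmetical operations. -/
inductive Op
  | add | sub | mul | div | mod | lt | eq

/-- The value of an operation on natural numbers: subtraction is truncated, `div` and `mod` are
quotient and remainder, and a comparison has the value `1` if it holds and `0` otherwise. -/
def Op.eval : Op → ℕ → ℕ → ℕ
  | .add, a, b => a + b
  | .sub, a, b => a - b
  | .mul, a, b => a * b
  | .div, a, b => a / b
  | .mod, a, b => a % b
  | .lt, a, b => if a < b then 1 else 0
  | .eq, a, b => if a = b then 1 else 0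

/-- The cost of an operation; `Nat.size` is the length of the binary expansion. -/
def Op.cost : Op → ℕ → ℕ → ℕ
  | .mul, a, b => (1 + a.size) * (1 + b.size)
  | .div, a, b => (1 + a.size) * (1 + b.size)
  | .mod, a, b => (1 + a.size) * (1 + b.size)
  | _, a, b => 1 + a.size + b.size

/-- The contents of the memory: `var x` is the value of the variable number `x`, and `arr a i` is
the entry with index `i` of the array number `a`. -/
@[ext] structure Store where
  var : ℕ → ℕ
  arr : ℕ → ℕ → ℕ

/-- Expressions: numerals, variables, array entries, and operations. -/
inductive Exp
  | lit (c : ℕ)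
  | var (x : ℕ)
  | get (a : ℕ) (i : Exp)
  | bin (o : Op) (e₁ e₂ : Exp)

/-- The value of an expression. -/
def Exp.eval (s : Store) : Exp → ℕ
  | .lit c => c
  | .var x => s.var x
  | .get a i => s.arr a (i.eval s)
  | .bin o e₁ e₂ => o.eval (e₁.eval s) (e₂.eval s)

/-- The cost of evaluating an expression. -/
def Exp.cost (s : Store) : Exp → ℕ
  | .lit c => 1 + c.size
  | .var x => 1 + (s.var x).size
  | .get a i => i.cost s + (1 + (i.eval s).size + (s.arr a (i.eval s)).size)
  | .bin o e₁ e₂ => e₁.cost s + e₂.cost s + o.cost (e₁.eval s) (e₂.eval s)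

/-- Programs: `assign x e` is the assignment of `e` to the variable `x`, and `put a i e` the
assignment of `e` to the entry with index `i` of the array `a`; a test succeeds if its value is
not `0`. -/
inductive Prog
  | skip
  | assign (x : ℕ) (e : Exp)
  | put (a : ℕ) (i e : Exp)
  | seq (p q : Prog)
  | ite (e : Exp) (p q : Prog)
  | loop (e : Exp) (p : Prog)

/-- The store after assigning the value `v` to the variable `x`. -/
def Store.setVar (s : Store) (x v : ℕ) : Store :=
  { s with var := Function.update s.var x v }

/-- The store after assigning the value `v` to the entry with index `i` of the array `a`. -/
def Store.setArr (s : Store) (a i v : ℕ) : Store :=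
  { s with arr := Function.update s.arr a (Function.update (s.arr a) i v) }

/-- `Exec p s t s'`: the program `p`, started in the store `s`, halts in the store `s'`, and the
total cost of the computation is `t`. -/
inductive Exec : Prog → Store → ℕ → Store → Prop
  | skip (s : Store) : Exec .skip s 1 s
  | assign (x : ℕ) (e : Exp) (s : Store) :
      Exec (.assign x e) s (e.cost s + (1 + (e.eval s).size)) (s.setVar x (e.eval s))
  | put (a : ℕ) (i e : Exp) (s : Store) :
      Exec (.put a i e) s (i.cost s + e.cost s + (1 + (i.eval s).size + (e.eval s).size))
        (s.setArr a (i.eval s) (e.eval s))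
  | seq {p q : Prog} {s₁ s₂ s₃ : Store} {t₁ t₂ : ℕ} :
      Exec p s₁ t₁ s₂ → Exec q s₂ t₂ s₃ → Exec (.seq p q) s₁ (t₁ + t₂) s₃
  | iteTrue {e : Exp} {p q : Prog} {s s' : Store} {t : ℕ} :
      e.eval s ≠ 0 → Exec p s t s' → Exec (.ite e p q) s (e.cost s + 1 + t) s'
  | iteFalse {e : Exp} {p q : Prog} {s s' : Store} {t : ℕ} :
      e.eval s = 0 → Exec q s t s' → Exec (.ite e p q) s (e.cost s + 1 + t) s'
  | loopTrue {e : Exp} {p : Prog} {s₁ s₂ s₃ : Store} {t₁ t₂ : ℕ} :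
      e.eval s₁ ≠ 0 → Exec p s₁ t₁ s₂ → Exec (.loop e p) s₂ t₂ s₃ →
        Exec (.loop e p) s₁ (e.cost s₁ + 1 + t₁ + t₂) s₃
  | loopFalse {e : Exp} {p : Prog} {s : Store} :
      e.eval s = 0 → Exec (.loop e p) s (e.cost s + 1) s

/-- Programs are deterministic: the final store and the cost are determined by the initial
store. -/
theorem Exec.unique {p : Prog} {s s₁ s₂ : Store} {t₁ t₂ : ℕ}
    (h₁ : Exec p s t₁ s₁) (h₂ : Exec p s t₂ s₂) : t₁ = t₂ ∧ s₁ = s₂ := by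
  induction h₁ generalizing t₂ s₂ with
  | skip s => cases h₂; exact ⟨rfl, rfl⟩
  | assign x e s => cases h₂; exact ⟨rfl, rfl⟩
  | put a i e s => cases h₂; exact ⟨rfl, rfl⟩
  | seq _ _ ih₁ ih₂ =>
    cases h₂ with
    | seq a b =>
      obtain ⟨rfl, rfl⟩ := ih₁ a
      obtain ⟨rfl, rfl⟩ := ih₂ b
      exact ⟨rfl, rfl⟩
  | iteTrue h _ ih =>
    cases h₂ with
    | iteTrue _ a => obtain ⟨rfl, rfl⟩ := ih a; exact ⟨rfl, rfl⟩
    | iteFalse h' _ => exact absurd h' h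
  | iteFalse h _ ih =>
    cases h₂ with
    | iteTrue h' _ => exact absurd h h'
    | iteFalse _ a => obtain ⟨rfl, rfl⟩ := ih a; exact ⟨rfl, rfl⟩
  | loopTrue h _ _ ih₁ ih₂ =>
    cases h₂ with
    | loopTrue _ a b =>
      obtain ⟨rfl, rfl⟩ := ih₁ a
      obtain ⟨rfl, rfl⟩ := ih₂ b
      exact ⟨rfl, rfl⟩
    | loopFalse h' => exact absurd h' h
  | loopFalse h =>
    cases h₂ with
    | loopTrue h' _ _ => exact absurd h h'
    | loopFalse _ => exact ⟨rfl, rfl⟩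

open Classical in
/-- The initial store for a poset on `{0, …, n - 1}`: the variable `0` holds `n`, the array `0`
holds the `n × n` zero-one matrix of the relation `r`, row by row, and everything else is `0`. -/
noncomputable def input {n : ℕ} (r : Fin n → Fin n → Prop) : Store where
  var x := if x = 0 then n else 0
  arr a k := if a = 0 ∧ ∃ i j : Fin n, k = i.val * n + j.val ∧ r i j then 1 else 0

end RAM

/-!
The program counts linear extensions by dynamic programming over down-sets, after every class of
twins (elements with the same strict lower and the same strict upper bounds) has been turned into a
chain.

*Correctness.* The number of linear extensions of `r` on a set `S` is the sum, over the minimal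
elements `x` of `S`, of the numbers for `S \ {x}` (`extCount_eq_sum_minimals`). Exchanging two twins
is an automorphism of `r`, so that the terms of twins are equal, and it suffices to remove the least
twin in `S`, with the number of its twins as a factor (`extCount_eq_sum_chainTwins`). Hence the
number of linear extensions is a weighted number of paths from the empty set to the whole set
through the down-sets of `chainTwins r`. A breadth-first search with a queue computes it: the sum
over the waiting sets `D` of the number of paths to `D` times the number of linear extensions of
the complement of `D` never changes (`pending`, `IsQueue.push_found`, `IsQueue.push_new`).

*Running time.* Each down-set of `chainTwins r` is processed once, in polynomial time, so all depends
on the number of these down-sets, which is at most `2 * 1.81 ^ n` in dimension two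
(`card_downSets_chainTwins_le`). Take a maximum matching with `m` pairs in the comparability graph.
The `k` unmatched elements form an antichain, and as there is no augmenting path with three edges,
the two elements of a pair cannot have different unmatched neighbours. In dimension two the
neighbourhood of an element in an antichain is an interval in the order of the first realizer, and
since different unmatched elements are not twins, these intervals separate the unmatched elements.
An interval has two ends, therefore `k ≤ 2 * m + 1` (`card_le_of_convex_of_separating`). Next choose
a maximal set of `j` pairs with distinct unmatched neighbours. The pairs that are not chosen have no
other neighbours than the chosen ones, so the `k - j` elements left over are separated by the chosen
pairs alone, and `k - j ≤ 2 * j + 1`. A down-set meets a pair in one of at most 3 ways, and a pair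
together with an unmatched neighbour in one of at most 5 ways, which gives the bound
`5 ^ j * 3 ^ (m - j) * 2 ^ (k - j)` (`exists_card_downSets_le`). With `n = 2 * m + k` and the two
inequalities this is at most `2 * 1.81 ^ n` (`packing_bound`), and `1.81 < 1.8172` leaves room for all
polynomial factors.

*Costs.* `RAM.Run` is a Hoare logic for total correctness with costs: if all numbers in memory keep
at most `W` binary digits, each elementary step costs a constant multiple of `(1 + W) ^ 2`, and here
`W` is quadratic in `n` (`RAM.digits`).
-/

/-! ### Linear extensions of a subset of a poset -/

section Extensions

variable {X : Type*}

/-- `L` is a strict total order on `S`, empty outside of `S`, that contains the restriction of `r`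
to `S`.  Keeping all orders on the ambient type avoids subtypes. -/
def IsExtensionOn (r : X → X → Prop) (S : Finset X) (L : X → X → Prop) : Prop :=
  (∀ x y, L x y → x ∈ S ∧ y ∈ S) ∧ (∀ x, ¬ L x x) ∧ (∀ x y z, L x y → L y z → L x z) ∧
    (∀ x ∈ S, ∀ y ∈ S, x ≠ y → L x y ∨ L y x) ∧ ∀ x ∈ S, ∀ y ∈ S, r x y → L x y

open Classical in
/-- The number of linear extensions of the restriction of `r` to `S`. -/
noncomputable def extCount [Fintype X] (r : X → X → Prop) (S : Finset X) : ℕ :=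
  (Finset.univ.filter (IsExtensionOn r S)).card

open Classical in
theorem extCount_le [Fintype X] (r : X → X → Prop) (S : Finset X) :
    extCount r S ≤ 2 ^ (Fintype.card X ^ 2) := by
  refine (Finset.card_le_univ _).trans_eq ?_
  simp [Fintype.card_pi, sq, pow_mul]

theorem numLinearExtensions_eq_extCount [Fintype X] (r : X → X → Prop) :
    numLinearExtensions r = extCount r Finset.univ := by
  classical
  rw [numLinearExtensions, extCount, Nat.card_eq_fintype_card, Fintype.card_subtype]
  refine congrArg _ (Finset.filter_congr fun L _ => ?_)
  simp only [IsLinearExtension, IsExtensionOn, Finset.mem_univ, implies_true, and_self,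
    forall_const, true_and]
  constructor
  · rintro ⟨h, hr⟩
    refine ⟨fun x => h.irrefl x, fun x y z => h.trans x y z, fun x y hxy => ?_, hr⟩
    by_contra hc
    push Not at hc
    exact hxy (h.trichotomous x y hc.1 hc.2)
  · rintro ⟨h1, h2, h3, h4⟩
    refine ⟨{ irrefl := h1, trans := h2, trichotomous := fun x y ha hb => ?_ }, h4⟩
    by_contra hc
    exact (h3 x y hc).elim ha hb

theorem extCount_empty [Fintype X] (r : X → X → Prop) : extCount r ∅ = 1 := by
  classical
  rw [extCount, Finset.card_eq_one]
  refine ⟨fun _ _ => False, ?_⟩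
  ext L
  simp only [IsExtensionOn, Finset.mem_filter, Finset.mem_univ, true_and, Finset.notMem_empty,
    Finset.mem_singleton, false_imp_iff, implies_true, and_true, and_self]
  constructor
  · rintro ⟨h, -, -⟩
    ext x y
    simpa using h x y
  · rintro rfl
    simp

open Classical in
/-- The elements of `S` that are minimal in `S`. -/
noncomputable def minimals (r : X → X → Prop) (S : Finset X) : Finset X :=
  S.filter fun x => ∀ y ∈ S, ¬ r y x

theorem mem_minimals {r : X → X → Prop} {S : Finset X} {x : X} :
    x ∈ minimals r S ↔ x ∈ S ∧ ∀ y ∈ S, ¬ r y x := by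
  simp [minimals]

theorem exists_first {r : X → X → Prop} {S : Finset X} (hS : S.Nonempty) {L : X → X → Prop}
    (hL : IsExtensionOn r S L) : ∃ x ∈ S, ∀ y ∈ S, y ≠ x → L x y := by
  obtain ⟨-, h2, h3, h4, -⟩ := hL
  have : ∀ T : Finset X, T.Nonempty → T ⊆ S → ∃ x ∈ T, ∀ y ∈ T, y ≠ x → L x y := by
    intro T hT
    induction hT using Finset.Nonempty.cons_induction with
    | singleton a => intro _; exact ⟨a, by simp, by simp⟩
    | cons a T ha hT ih =>
      intro hTS
      obtain ⟨x, hx, hxy⟩ := ih fun y hy => hTS (Finset.mem_cons_of_mem hy)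
      have hax : a ≠ x := fun h => ha (h ▸ hx)
      rcases h4 a (hTS (by simp)) x (hTS (Finset.mem_cons_of_mem hx)) hax with h | h
      · refine ⟨a, by simp, fun y hy hya => ?_⟩
        rcases Finset.mem_cons.1 hy with rfl | hy
        · exact absurd rfl hya
        · by_cases hyx : y = x
          · exact hyx ▸ h
          · exact h3 _ _ _ h (hxy y hy hyx)
      · refine ⟨x, by simp [hx], fun y hy hyx => ?_⟩
        rcases Finset.mem_cons.1 hy with rfl | hy
        · exact h
        · exact hxy y hy hyx
  exact this S hS subset_rfl

/-- Splitting off the first element of a linear extension. -/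
theorem extCount_eq_sum_minimals [Fintype X] [DecidableEq X] {r : X → X → Prop}
    [Std.Irrefl r] {S : Finset X}
    (hS : S.Nonempty) :
    extCount r S = ∑ x ∈ minimals r S, extCount r (S.erase x) := by
  classical
  let f : X → (X → X → Prop) → X → X → Prop := fun x L y z => L y z ∨ (y = x ∧ z ∈ S.erase x)
  have key : Finset.univ.filter (IsExtensionOn r S) = (minimals r S).biUnion fun x =>
      (Finset.univ.filter (IsExtensionOn r (S.erase x))).image (f x) := by
    ext L
    simp only [Finset.mem_filter, Finset.mem_univ, true_and, Finset.mem_biUnion, Finset.mem_image]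
    constructor
    · intro hL
      obtain ⟨x, hx, hxy⟩ := exists_first hS hL
      obtain ⟨h1, h2, h3, h4, h5⟩ := hL
      have hmin : ∀ y, ¬ L y x := by
        intro y hy
        have hyx : y ≠ x := fun h => h2 x (h ▸ hy)
        exact h2 x (h3 _ _ _ (hxy y (h1 _ _ hy).1 hyx) hy)
      refine ⟨x, mem_minimals.2 ⟨hx, fun y hy h => hmin y (h5 y hy x hx h)⟩,
        fun y z => L y z ∧ y ≠ x, ⟨?_, ?_, ?_, ?_, ?_⟩, ?_⟩
      · rintro y z ⟨h, hyx⟩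
        have hzx : z ≠ x := fun hz => hmin y (hz ▸ h)
        simp [hyx, hzx, h1 _ _ h]
      · exact fun y h => h2 y h.1
      · exact fun a b c h h' => ⟨h3 a b c h.1 h'.1, h.2⟩
      · intro a ha b hb hab
        simp only [Finset.mem_erase] at ha hb
        rcases h4 a ha.2 b hb.2 hab with h | h
        · exact Or.inl ⟨h, ha.1⟩
        · exact Or.inr ⟨h, hb.1⟩
      · intro a ha b hb hab
        simp only [Finset.mem_erase] at ha hb
        exact ⟨h5 a ha.2 b hb.2 hab, ha.1⟩
      · ext y z
        simp only [f, Finset.mem_erase]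
        constructor
        · rintro (h | ⟨rfl, h, h'⟩)
          · exact h.1
          · exact hxy z h' h
        · intro h
          by_cases hyx : y = x
          · exact Or.inr ⟨hyx, fun hz => hmin y (hz ▸ h), (h1 _ _ h).2⟩
          · exact Or.inl ⟨h, hyx⟩
    · rintro ⟨x, hx, L, ⟨h1, h2, h3, h4, h5⟩, rfl⟩
      obtain ⟨hxS, hxm⟩ := mem_minimals.1 hx
      simp only [Finset.mem_erase] at h1 h4 h5
      refine ⟨?_, ?_, ?_, ?_, ?_⟩ <;> simp only [f, Finset.mem_erase]
      · rintro y z (h | ⟨rfl, h⟩)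
        · exact ⟨(h1 _ _ h).1.2, (h1 _ _ h).2.2⟩
        · exact ⟨hxS, h.2⟩
      · rintro y (h | ⟨rfl, h, -⟩)
        · exact h2 _ h
        · exact h rfl
      · rintro a b c (h | ⟨rfl, h, h'⟩) (k | ⟨rfl, k, k'⟩)
        · exact Or.inl (h3 _ _ _ h k)
        · exact absurd rfl (h1 _ _ h).2.1
        · exact Or.inr ⟨rfl, (h1 _ _ k).2⟩
        · exact absurd rfl h
      · intro a ha b hb hab
        by_cases hax : a = x
        · exact Or.inl (Or.inr ⟨hax, fun h => hab (hax.trans h.symm), hb⟩)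
        · by_cases hbx : b = x
          · exact Or.inr (Or.inr ⟨hbx, hax, ha⟩)
          · exact (h4 a ⟨hax, ha⟩ b ⟨hbx, hb⟩ hab).imp Or.inl Or.inl
      · intro a ha b hb hab
        have hbx : b ≠ x := fun h => hxm a ha (h ▸ hab)
        by_cases hax : a = x
        · exact Or.inr ⟨hax, hbx, hb⟩
        · exact Or.inl (h5 a ⟨hax, ha⟩ b ⟨hbx, hb⟩ hab)
  have hc : ∀ T, extCount r T = (Finset.univ.filter (IsExtensionOn r T)).card := fun T => by
    rw [extCount]
    congr!
  rw [hc, key, Finset.card_biUnion]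
  · refine Finset.sum_congr rfl fun x hx => ?_
    rw [Finset.card_image_of_injOn, hc]
    intro L hL L' hL' h
    simp only [Finset.coe_filter, Finset.mem_univ, true_and, Set.mem_ofPred_eq] at hL hL'
    ext y z
    have := congrFun (congrFun h y) z
    simp only [f, eq_iff_iff] at this
    constructor
    · intro hyz
      rcases this.1 (Or.inl hyz) with h | h
      · exact h
      · exact absurd h.1 (Finset.ne_of_mem_erase (hL.1 _ _ hyz).1)
    · intro hyz
      rcases this.2 (Or.inl hyz) with h | h
      · exact h
      · exact absurd h.1 (Finset.ne_of_mem_erase (hL'.1 _ _ hyz).1)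
  · intro x hx y hy hxy
    rw [Function.onFun, Finset.disjoint_left]
    simp only [Finset.mem_image, Finset.mem_filter, Finset.mem_univ, true_and]
    rintro _ ⟨L, hL, rfl⟩ ⟨L', hL', h⟩
    have hxS := (mem_minimals.1 hx).1
    have hyS := (mem_minimals.1 hy).1
    have h1 := congrFun (congrFun h y) x
    simp only [f, eq_iff_iff, Finset.mem_erase] at h1
    rcases h1.1 (Or.inr ⟨trivial, hxy, hxS⟩) with h' | h'
    · exact (Finset.ne_of_mem_erase (hL.1 _ _ h').2) rfl
    · exact hxy h'.1.symm

theorem minimals_nonempty {r : X → X → Prop} [IsStrictOrder X r] {S : Finset X}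
    (hS : S.Nonempty) : (minimals r S).Nonempty := by
  obtain ⟨x, hx, h⟩ := (Set.wellFoundedOn_iff.1
    (S.finite_toSet.wellFoundedOn (r := r))).has_min (S : Set X) hS
  exact ⟨x, mem_minimals.2 ⟨hx, fun y hy hyx => h y hy ⟨hyx, hy, hx⟩⟩⟩

theorem extCount_pos [Fintype X] [DecidableEq X] (r : X → X → Prop) [IsStrictOrder X r] (S : Finset X) :
    0 < extCount r S := by
  induction S using Finset.strongInduction with
  | H S ih =>
    rcases S.eq_empty_or_nonempty with rfl | hS
    · simp [extCount_empty]
    · rw [extCount_eq_sum_minimals hS]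
      exact Finset.sum_pos (fun x hx => ih _ (Finset.erase_ssubset (mem_minimals.1 hx).1))
        (minimals_nonempty hS)

/-- Automorphisms of `r` preserve the number of linear extensions. -/
theorem extCount_map [Fintype X] {r : X → X → Prop} (σ : Equiv.Perm X)
    (hσ : ∀ x y, r (σ x) (σ y) ↔ r x y) (S : Finset X) :
    extCount r (S.map σ.toEmbedding) = extCount r S := by
  classical
  have key : ∀ L : X → X → Prop, IsExtensionOn r (S.map σ.toEmbedding) L ↔
      IsExtensionOn r S (fun x y => L (σ x) (σ y)) := by
    intro L
    have hm : ∀ x, σ x ∈ S.map σ.toEmbedding ↔ x ∈ S := fun x => by simp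
    constructor
    · rintro ⟨h1, h2, h3, h4, h5⟩
      exact ⟨fun x y h => ⟨(hm x).1 (h1 _ _ h).1, (hm y).1 (h1 _ _ h).2⟩, fun x => h2 _,
        fun x y z => h3 _ _ _,
        fun x hx y hy h => h4 _ ((hm x).2 hx) _ ((hm y).2 hy) (σ.injective.ne h),
        fun x hx y hy h => h5 _ ((hm x).2 hx) _ ((hm y).2 hy) ((hσ x y).2 h)⟩
    · rintro ⟨h1, h2, h3, h4, h5⟩
      refine ⟨?_, ?_, ?_, ?_, ?_⟩ <;> intro x <;> obtain ⟨x, rfl⟩ := σ.surjective x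
      · intro y
        obtain ⟨y, rfl⟩ := σ.surjective y
        exact fun h => ⟨(hm x).2 (h1 _ _ h).1, (hm y).2 (h1 _ _ h).2⟩
      · exact h2 x
      · intro y z
        obtain ⟨y, rfl⟩ := σ.surjective y
        obtain ⟨z, rfl⟩ := σ.surjective z
        exact h3 x y z
      · intro hx y
        obtain ⟨y, rfl⟩ := σ.surjective y
        exact fun hy h => h4 x ((hm x).1 hx) y ((hm y).1 hy) fun e => h (e ▸ rfl)
      · intro hx y
        obtain ⟨y, rfl⟩ := σ.surjective y
        exact fun hy h => h5 x ((hm x).1 hx) y ((hm y).1 hy) ((hσ x y).1 h)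
  refine Finset.card_bij (fun L _ x y => L (σ x) (σ y)) ?_ ?_ ?_
  · intro L hL
    simpa [key] using hL
  · intro L _ L' _ h
    ext x y
    simpa using congrFun (congrFun h (σ.symm x)) (σ.symm y)
  · intro L hL
    refine ⟨fun x y => L (σ.symm x) (σ.symm y), ?_, ?_⟩
    · simpa [key] using hL
    · simp

end Extensions

/-! ### Twins -/

section Twins

variable {X : Type*}

/-- Two elements are twins if they have the same strict lower bounds and the same strict upper
bounds.  Every element is a twin of itself. -/
def Twin (r : X → X → Prop) (x y : X) : Prop :=
  ∀ z, (r x z ↔ r y z) ∧ (r z x ↔ r z y)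

theorem Twin.refl (r : X → X → Prop) (x : X) : Twin r x x := fun _ => ⟨Iff.rfl, Iff.rfl⟩

theorem Twin.symm {r : X → X → Prop} {x y : X} (h : Twin r x y) : Twin r y x :=
  fun z => ⟨(h z).1.symm, (h z).2.symm⟩

theorem Twin.trans {r : X → X → Prop} {x y z : X} (h : Twin r x y) (h' : Twin r y z) :
    Twin r x z :=
  fun w => ⟨(h w).1.trans (h' w).1, (h w).2.trans (h' w).2⟩

theorem Twin.not_rel {r : X → X → Prop} [Std.Irrefl r] {x y : X} (h : Twin r x y) : ¬ r x y :=
  fun hr => Std.Irrefl.irrefl (r := r) y ((h y).1.1 hr)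

/-- Swapping two twins is an automorphism. -/
theorem Twin.swap [DecidableEq X] {r : X → X → Prop} [Std.Irrefl r] {x y : X} (h : Twin r x y)
    (a b : X) : r (Equiv.swap x y a) (Equiv.swap x y b) ↔ r a b := by
  have hxx := Std.Irrefl.irrefl (r := r) x
  have hyy := Std.Irrefl.irrefl (r := r) y
  have h1 := h.not_rel
  have h2 := h.symm.not_rel
  rw [Equiv.swap_apply_def, Equiv.swap_apply_def]
  split_ifs with h3 h4 h5 h6 h7 h8 h9 <;> subst_vars <;>
    first
    | tauto
    | exact (h _).1.symm
    | exact (h _).2.symm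
    | exact (h _).1
    | exact (h _).2

theorem extCount_erase_twin [Fintype X] [DecidableEq X] {r : X → X → Prop} [Std.Irrefl r]
    {S : Finset X} {x y : X} (hx : x ∈ S) (hy : y ∈ S) (h : Twin r x y) :
    extCount r (S.erase x) = extCount r (S.erase y) := by
  rw [← extCount_map (Equiv.swap x y) h.swap (S.erase x)]
  congr 1
  ext z
  rw [Finset.mem_map_equiv, Equiv.symm_swap, Equiv.swap_apply_def]
  simp only [Finset.mem_erase]
  split_ifs with h1 h2
  · subst h1
    by_cases hz : z = y <;> simp_all [eq_comm]
  · subst h2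
    simp
  · tauto

/-- The order `r` with every class of twins turned into a chain. -/
def chainTwins [LT X] (r : X → X → Prop) (x y : X) : Prop :=
  r x y ∨ (Twin r x y ∧ x < y)

open Classical in
/-- The recursion for the number of linear extensions in which, among the twins in `S`, only the
least one is ever removed. -/
theorem extCount_eq_sum_chainTwins [Fintype X] [LinearOrder X] {r : X → X → Prop} [Std.Irrefl r]
    {S : Finset X} (hS : S.Nonempty) :
    extCount r S = ∑ y ∈ minimals (chainTwins r) S,
      (S.filter (Twin r y)).card * extCount r (S.erase y) := by
  have h1 : minimals r S = (minimals (chainTwins r) S).biUnion fun y => S.filter (Twin r y) := by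
    ext x
    simp only [mem_minimals, Finset.mem_biUnion, Finset.mem_filter]
    constructor
    · rintro ⟨hx, hm⟩
      have hne : (S.filter (Twin r x)).Nonempty := ⟨x, by simp [hx, Twin.refl]⟩
      have hy := Finset.min'_mem _ hne
      set y := (S.filter (Twin r x)).min' hne with hy'
      rw [Finset.mem_filter] at hy
      refine ⟨y, ⟨hy.1, ?_⟩, hx, hy.2.symm⟩
      rintro z hz (h | ⟨h, hlt⟩)
      · exact hm z hz ((hy.2 z).2.2 h)
      · exact absurd (Finset.min'_le _ z (by simp [hz, hy.2.trans h.symm])) (not_le.2 hlt)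
    · rintro ⟨y, ⟨hy, hm⟩, hx, h⟩
      exact ⟨hx, fun z hz hzx => hm z hz (Or.inl ((h z).2.2 hzx))⟩
  rw [extCount_eq_sum_minimals hS, h1, Finset.sum_biUnion]
  · refine Finset.sum_congr rfl fun y hy => ?_
    rw [← smul_eq_mul]
    refine Finset.sum_eq_card_nsmul fun x hx => ?_
    rw [Finset.mem_filter] at hx
    exact (extCount_erase_twin (mem_minimals.1 hy).1 hx.1 hx.2).symm
  · intro y hy z hz hyz
    rw [Function.onFun, Finset.disjoint_left]
    intro x hxy hxz
    rw [Finset.mem_filter] at hxy hxz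
    obtain ⟨hyS, hym⟩ := mem_minimals.1 hy
    obtain ⟨hzS, hzm⟩ := mem_minimals.1 hz
    have h := hxy.2.trans hxz.2.symm
    rcases lt_or_gt_of_ne hyz with hlt | hlt
    · exact hzm y hyS (Or.inr ⟨h, hlt⟩)
    · exact hym z hzS (Or.inr ⟨h.symm, hlt⟩)

end Twins

/-! ### Counting down-sets through a cover of the ground set -/

section DownSets

variable {X : Type*}

open Classical in
/-- The sets that are down-closed with respect to the restriction of `q` to `S`. -/
noncomputable def downSets (q : X → X → Prop) (S : Finset X) : Finset (Finset X) :=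
  S.powerset.filter fun D => ∀ x ∈ D, ∀ y ∈ S, q y x → y ∈ D

theorem mem_downSets {q : X → X → Prop} {S D : Finset X} :
    D ∈ downSets q S ↔ D ⊆ S ∧ ∀ x ∈ D, ∀ y ∈ S, q y x → y ∈ D := by
  simp [downSets]

theorem card_downSets_le (q : X → X → Prop) (S : Finset X) :
    (downSets q S).card ≤ 2 ^ S.card := by
  rw [← Finset.card_powerset]
  exact Finset.card_le_card fun D hD => Finset.mem_powerset.2 (mem_downSets.1 hD).1

/-- Comparability. -/
def Comp (q : X → X → Prop) (x y : X) : Prop := q x y ∨ q y x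

theorem Comp.symm {q : X → X → Prop} {x y : X} (h : Comp q x y) : Comp q y x := Or.symm h

theorem Comp.ne {q : X → X → Prop} [Std.Irrefl q] {x y : X} (h : Comp q x y) : x ≠ y := by
  rintro rfl
  exact h.elim (Std.Irrefl.irrefl x) (Std.Irrefl.irrefl x)

variable [DecidableEq X]

theorem card_downSets_union_le (q : X → X → Prop) (S T : Finset X) :
    (downSets q (S ∪ T)).card ≤ (downSets q S).card * (downSets q T).card := by
  rw [← Finset.card_product]
  refine Finset.card_le_card_of_injOn (fun D => (D ∩ S, D ∩ T)) ?_ ?_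
  · intro D hD
    obtain ⟨-, h⟩ := mem_downSets.1 hD
    simp only [Finset.coe_product, Set.mem_prod, Finset.mem_coe, mem_downSets, Finset.mem_inter]
    exact ⟨⟨Finset.inter_subset_right, fun x hx y hy hq =>
        ⟨h x hx.1 y (Finset.mem_union_left _ hy) hq, hy⟩⟩,
      ⟨Finset.inter_subset_right, fun x hx y hy hq =>
        ⟨h x hx.1 y (Finset.mem_union_right _ hy) hq, hy⟩⟩⟩
  · intro D hD E hE h
    have hDs := (mem_downSets.1 hD).1
    have hEs := (mem_downSets.1 hE).1
    simp only [Prod.mk.injEq] at h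
    rw [← Finset.inter_eq_left.2 hDs, ← Finset.inter_eq_left.2 hEs,
      Finset.inter_union_distrib_left, Finset.inter_union_distrib_left, h.1, h.2]

theorem card_downSets_biUnion_le {ι : Type*} [DecidableEq ι] (q : X → X → Prop) (I : Finset ι)
    (S : ι → Finset X) (c : ℕ) (h : ∀ i ∈ I, (downSets q (S i)).card ≤ c) :
    (downSets q (I.biUnion S)).card ≤ c ^ I.card := by
  induction I using Finset.induction_on with
  | empty => simpa using card_downSets_le q ∅
  | insert i I hi ih =>
    rw [Finset.biUnion_insert, Finset.card_insert_of_notMem hi, pow_succ']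
    exact (card_downSets_union_le q _ _).trans (Nat.mul_le_mul (h i (by simp))
      (ih fun j hj => h j (by simp [hj])))

/-- Sets that are not down-closed may be discarded from the count. -/
theorem card_downSets_add_le (q : X → X → Prop) (S : Finset X) (B : Finset (Finset X))
    (hB : ∀ D ∈ B, D ⊆ S ∧ ∃ x ∈ D, ∃ y ∈ S, q y x ∧ y ∉ D) :
    (downSets q S).card + B.card ≤ 2 ^ S.card := by
  rw [← Finset.card_powerset, ← Finset.card_union_of_disjoint]
  · refine Finset.card_le_card (Finset.union_subset (fun D hD => ?_) fun D hD => ?_)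
    · exact Finset.mem_powerset.2 (mem_downSets.1 hD).1
    · exact Finset.mem_powerset.2 (hB D hD).1
  · rw [Finset.disjoint_right]
    intro D hD hD'
    obtain ⟨-, x, hx, y, hy, hq, hn⟩ := hB D hD
    exact hn ((mem_downSets.1 hD').2 x hx y hy hq)

theorem card_downSets_pair_le {q : X → X → Prop} [Std.Irrefl q] {x y : X} (h : Comp q x y) :
    (downSets q {x, y}).card ≤ 3 := by
  have hxy := h.ne
  have h4 : ({x, y} : Finset X).card = 2 := Finset.card_pair hxy
  rcases h with h | h
  · have := card_downSets_add_le q {x, y} {{y}} (by simp [h, hxy])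
    simp [h4] at this
    omega
  · have := card_downSets_add_le q {x, y} {{x}} (by simp [h, hxy.symm])
    simp [h4] at this
    omega

theorem card_downSets_triple_le {q : X → X → Prop} [Std.Irrefl q] {x y z : X} (h : Comp q x y)
    (h' : Comp q x z) (hyz : y ≠ z) : (downSets q {x, y, z}).card ≤ 5 := by
  have hxy := h.ne
  have hxz := h'.ne
  have h3 : ({x, y, z} : Finset X).card = 3 := Finset.card_eq_three.2 ⟨x, y, z, hxy, hxz, hyz, rfl⟩
  have key : ∀ a b c : Finset X, a ≠ b → a ≠ c → b ≠ c →
      (∀ D ∈ ({a, b, c} : Finset (Finset X)),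
        D ⊆ {x, y, z} ∧ ∃ u ∈ D, ∃ v ∈ ({x, y, z} : Finset X), q v u ∧ v ∉ D) →
      (downSets q {x, y, z}).card ≤ 5 := by
    intro a b c hab hac hbc hB
    have := card_downSets_add_le q {x, y, z} {a, b, c} hB
    rw [h3, Finset.card_eq_three.2 ⟨a, b, c, hab, hac, hbc, rfl⟩] at this
    omega
  have hne : ∀ {a b c : X}, a ≠ b → a ≠ c → b ≠ c → ({a} : Finset X) ≠ {b} ∧
      ({a} : Finset X) ≠ {a, c} ∧ ({a} : Finset X) ≠ {b, a} ∧ ({a} : Finset X) ≠ {a, b} ∧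
      ({a} : Finset X) ≠ {c, a} ∧ ({a, b} : Finset X) ≠ {a, c} := by
    intro a b c hab hac hbc
    simp only [ne_eq, Finset.ext_iff, Finset.mem_singleton, Finset.mem_insert]
    refine ⟨fun h => ?_, fun h => ?_, fun h => ?_, fun h => ?_, fun h => ?_, fun h => ?_⟩
    · exact hab ((h a).1 rfl)
    · exact hac ((h c).2 (by simp)).symm
    · exact hab ((h b).2 (by simp)).symm
    · exact hab ((h b).2 (by simp)).symm
    · exact hac ((h c).2 (by simp)).symm
    · exact ((h b).1 (by simp)).elim hab.symm hbc
  rcases h with h | h <;> rcases h' with h' | h'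
  · refine key {y} {z} {y, z} (hne hyz hxy.symm hxz.symm).1 (hne hxy.symm hyz hxz).2.1
      (hne hyz.symm hxz.symm hxy.symm).2.2.1 ?_
    simp [h, h', hxy, hxz, hyz, Finset.subset_iff]
  · refine key {x} {y} {x, y} (hne hxy hxz hyz).1 (hne hxy hxz hyz).2.2.2.1
      (hne hxy.symm hyz hxz).2.2.1 ?_
    simp [h, h', hxy, hxz, hyz, hxz.symm, hyz.symm, Finset.subset_iff]
  · refine key {x} {z} {x, z} (hne hxz hxy hyz.symm).1 (hne hxz hxy hyz.symm).2.2.2.1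
      (hne hxz.symm hyz.symm hxy).2.2.1 ?_
    simp [h, h', hxy, hxz, hyz, hxy.symm, hyz.symm, Finset.subset_iff]
  · refine key {x} {x, y} {x, z} (hne hxy hxz hyz).2.2.2.1 (hne hxy hxz hyz).2.1
      (hne hxy hxz hyz).2.2.2.2.2 ?_
    simp [h, h', hxy, hxz, hyz, hxy.symm, hyz.symm, hxz.symm, Finset.subset_iff]

end DownSets

/-! ### Convex sets that separate points -/

/-- If convex subsets of a finite linear order separate its points, then every gap between
consecutive points is a left or a right end of one of them, and each of them has only two ends. -/
theorem card_le_of_convex_of_separating {X ι : Type*} [LinearOrder X] [DecidableEq ι]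
    (A : Finset X) (E : Finset ι) (N : ι → X → Prop)
    (hconv : ∀ e ∈ E, ∀ a ∈ A, ∀ b ∈ A, ∀ c ∈ A, a < b → b < c → N e a → N e c → N e b)
    (hsep : ∀ a ∈ A, ∀ b ∈ A, a ≠ b → ∃ e ∈ E, ¬ (N e a ↔ N e b)) :
    A.card ≤ 2 * E.card + 1 := by
  classical
  rcases A.eq_empty_or_nonempty with rfl | hA
  · simp
  rcases isEmpty_or_nonempty ι with hι | hι
  · refine (Finset.card_le_one.2 fun a ha b hb => ?_).trans (by omega)
    by_contra hab
    exact hι.elim (hsep a ha b hb hab).choose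
  have hne : ∀ a ∈ A.erase (A.max' hA), (A.filter (a < ·)).Nonempty := by
    intro a ha
    rw [Finset.mem_erase] at ha
    exact ⟨A.max' hA, by
      rw [Finset.mem_filter]
      exact ⟨A.max'_mem hA, lt_of_le_of_ne (A.le_max' a ha.2) ha.1⟩⟩
  have hs : ∀ a ∈ A.erase (A.max' hA), ∃ s ∈ A, a < s ∧ (∀ b ∈ A, a < b → s ≤ b) ∧
      ∃ e ∈ E, ¬ (N e a ↔ N e s) := by
    intro a ha
    have h := Finset.min'_mem _ (hne a ha)
    set s := (A.filter (a < ·)).min' (hne a ha) with hs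
    rw [Finset.mem_filter] at h
    exact ⟨s, h.1, h.2, fun b hb hab => Finset.min'_le _ _ (by simp [hb, hab]),
      hsep a (Finset.mem_of_mem_erase ha) s h.1 h.2.ne⟩
  choose! s hsA has hmin e heE hes using hs
  have hcard : (A.erase (A.max' hA)).card ≤ (E ×ˢ (Finset.univ : Finset Bool)).card := by
    refine Finset.card_le_card_of_injOn (fun a => (e a, decide (N (e a) a))) ?_ ?_
    · intro a ha
      exact Finset.mem_product.2 ⟨heE a ha, Finset.mem_univ _⟩
    · have key : ∀ a ∈ A.erase (A.max' hA), ∀ b ∈ A.erase (A.max' hA), a < b → e a = e b →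
          (N (e a) a ↔ N (e b) b) → False := by
        intro a ha b hb hab heq hiff
        have h1 := hes a ha
        have h2 := hes b hb
        have haA := Finset.mem_of_mem_erase ha
        have hbA := Finset.mem_of_mem_erase hb
        have hsb := hmin a ha b hbA hab
        rw [← heq] at h2 hiff
        rcases hsb.eq_or_lt with h | h
        · rw [h] at h1
          exact h1 hiff
        · have h3 := hconv _ (heE a ha) a haA (s a) (hsA a ha) b hbA (has a ha) h
          have h4 := hconv _ (heE a ha) (s a) (hsA a ha) b hbA (s b) (hsA b hb) h (has b hb)
          tauto
      intro a ha b hb hab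
      simp only [Prod.mk.injEq, decide_eq_decide] at hab
      rcases lt_trichotomy a b with h | h | h
      · exact (key a ha b hb h hab.1 hab.2).elim
      · exact h
      · exact (key b hb a ha h hab.1.symm hab.2.symm).elim
  rw [Finset.card_erase_of_mem (A.max'_mem hA), Finset.card_product] at hcard
  simp at hcard
  omega

/-! ### Maximum matchings in the comparability graph -/

section Matchings

variable {X : Type*} [DecidableEq X]

/-- The elements covered by a set of pairs. -/
def covered (M : Finset (X × X)) : Finset X := M.biUnion fun p => {p.1, p.2}

theorem mem_covered {M : Finset (X × X)} {x : X} :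
    x ∈ covered M ↔ ∃ p ∈ M, x = p.1 ∨ x = p.2 := by
  simp [covered]

/-- A set of pairwise disjoint pairs of comparable elements; the orientation of a pair has no
meaning. -/
def IsMatching (q : X → X → Prop) (M : Finset (X × X)) : Prop :=
  (∀ p ∈ M, Comp q p.1 p.2) ∧
    ∀ p ∈ M, ∀ p' ∈ M, p ≠ p' → Disjoint ({p.1, p.2} : Finset X) {p'.1, p'.2}

theorem card_covered {q : X → X → Prop} [Std.Irrefl q] {M : Finset (X × X)}
    (hM : IsMatching q M) : (covered M).card = 2 * M.card := by
  rw [covered, Finset.card_biUnion hM.2, mul_comm]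
  exact Finset.sum_const_nat fun p hp => Finset.card_pair (hM.1 p hp).ne

theorem IsMatching.insert {q : X → X → Prop} {M : Finset (X × X)}
    (hM : IsMatching q M) {a b : X} (hab : Comp q a b) (ha : a ∉ covered M) (hb : b ∉ covered M) :
    IsMatching q (insert (a, b) M) ∧ (insert (a, b) M).card = M.card + 1 ∧
      ∀ x, x ∈ covered (insert (a, b) M) ↔ x = a ∨ x = b ∨ x ∈ covered M := by
  have hd : ∀ p ∈ M, Disjoint ({a, b} : Finset X) {p.1, p.2} := by
    intro p hp
    rw [Finset.disjoint_right]
    intro x hx hx'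
    have hxM : x ∈ covered M := mem_covered.2 ⟨p, hp, by simpa using hx⟩
    rcases Finset.mem_insert.1 hx' with rfl | hx'
    · exact ha hxM
    · exact hb (Finset.mem_singleton.1 hx' ▸ hxM)
  refine ⟨⟨?_, ?_⟩, Finset.card_insert_of_notMem fun h => ha (mem_covered.2 ⟨_, h, Or.inl rfl⟩), ?_⟩
  · intro p hp
    rcases Finset.mem_insert.1 hp with rfl | hp
    · exact hab
    · exact hM.1 p hp
  · intro p hp p' hp' hne
    rcases Finset.mem_insert.1 hp with rfl | hp <;> rcases Finset.mem_insert.1 hp' with rfl | hp'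
    · exact absurd rfl hne
    · exact hd p' hp'
    · exact (hd p hp).symm
    · exact hM.2 p hp p' hp' hne
  · intro x
    simp [covered]

theorem IsMatching.erase {q : X → X → Prop} {M : Finset (X × X)} (hM : IsMatching q M)
    {p : X × X} (hp : p ∈ M) : IsMatching q (M.erase p) ∧
      p.1 ∉ covered (M.erase p) ∧ p.2 ∉ covered (M.erase p) := by
  have h : ∀ x ∈ ({p.1, p.2} : Finset X), x ∉ covered (M.erase p) := by
    intro x hx hx'
    obtain ⟨p', hp', hx'⟩ := mem_covered.1 hx'
    rw [Finset.mem_erase] at hp'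
    exact Finset.disjoint_left.1 (hM.2 p hp p' hp'.2 hp'.1.symm) hx (by simpa using hx')
  exact ⟨⟨fun p' hp' => hM.1 p' (Finset.mem_of_mem_erase hp'), fun p' hp' p'' hp'' =>
    hM.2 p' (Finset.mem_of_mem_erase hp') p'' (Finset.mem_of_mem_erase hp'')⟩,
    h _ (by simp), h _ (by simp)⟩

/-- A maximum matching has no augmenting path with one or three edges. -/
theorem exists_maximum_matching [Fintype X] (q : X → X → Prop) [Std.Irrefl q] :
    ∃ M : Finset (X × X), IsMatching q M ∧
      (∀ a ∉ covered M, ∀ b ∉ covered M, ¬ Comp q a b) ∧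
      ∀ p ∈ M, ∀ a ∉ covered M, ∀ b ∉ covered M, a ≠ b → ¬ (Comp q p.1 a ∧ Comp q p.2 b) := by
  classical
  obtain ⟨M, hM, hmax⟩ := Finset.exists_max_image
    (Finset.univ.filter fun M : Finset (X × X) => IsMatching q M) Finset.card
    ⟨∅, by simp [IsMatching]⟩
  simp only [Finset.mem_filter, Finset.mem_univ, true_and] at hM hmax
  refine ⟨M, hM, fun a ha b hb hab => ?_, fun p hp a ha b hb hab ⟨h1, h2⟩ => ?_⟩
  · obtain ⟨h1, h2, -⟩ := hM.insert hab ha hb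
    have := hmax _ h1
    omega
  · obtain ⟨h3, h4, h5⟩ := hM.erase hp
    have hsub : ∀ x, x ∉ covered M → x ∉ covered (M.erase p) := fun x hx hx' => by
      obtain ⟨p', hp', h⟩ := mem_covered.1 hx'
      exact hx (mem_covered.2 ⟨p', Finset.mem_of_mem_erase hp', h⟩)
    have hp1 : p.1 ∈ covered M := mem_covered.2 ⟨p, hp, Or.inl rfl⟩
    have hp2 : p.2 ∈ covered M := mem_covered.2 ⟨p, hp, Or.inr rfl⟩
    obtain ⟨h6, h7, h8⟩ := h3.insert h1 h4 (hsub a ha)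
    have hn2 : p.2 ∉ covered (insert (p.1, a) (M.erase p)) := by
      rw [h8]
      rintro (h | h | h)
      · exact (hM.1 p hp).ne h.symm
      · exact ha (h ▸ hp2)
      · exact h5 h
    have hnb : b ∉ covered (insert (p.1, a) (M.erase p)) := by
      rw [h8]
      rintro (h | h | h)
      · exact hb (h ▸ hp1)
      · exact hab h.symm
      · exact hsub b hb h
    obtain ⟨h9, h10, -⟩ := h6.insert h2 hn2 hnb
    have := hmax _ h9
    have := Finset.card_erase_add_one hp
    omega

/-- A maximal set of disjoint representatives: a maximal partial injection `J` from `I` to `A`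
inside the relation `N`. -/
theorem exists_maximal_representatives {ι : Type*} [DecidableEq ι] (I : Finset ι) (A : Finset X)
    (N : ι → X → Prop) :
    ∃ J ⊆ I ×ˢ A, (∀ j ∈ J, N j.1 j.2) ∧ (J.image Prod.fst).card = J.card ∧
      (J.image Prod.snd).card = J.card ∧
      ∀ i ∈ I, i ∉ J.image Prod.fst → ∀ a ∈ A, N i a → a ∈ J.image Prod.snd := by
  classical
  obtain ⟨J, hJ, hmax⟩ := Finset.exists_max_image
    ((I ×ˢ A).powerset.filter fun J => (∀ j ∈ J, N j.1 j.2) ∧ (J.image Prod.fst).card = J.card ∧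
      (J.image Prod.snd).card = J.card) Finset.card ⟨∅, by simp⟩
  simp only [Finset.mem_filter, Finset.mem_powerset] at hJ hmax
  refine ⟨J, hJ.1, hJ.2.1, hJ.2.2.1, hJ.2.2.2, fun i hi hiJ a ha hN => ?_⟩
  by_contra haJ
  have hn : (i, a) ∉ J := fun h => hiJ (Finset.mem_image_of_mem Prod.fst h)
  have := hmax (insert (i, a) J) ⟨?_, ?_, ?_, ?_⟩
  · rw [Finset.card_insert_of_notMem hn] at this
    omega
  · exact Finset.insert_subset (Finset.mem_product.2 ⟨hi, ha⟩) hJ.1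
  · intro j hj
    rcases Finset.mem_insert.1 hj with rfl | hj
    · exact hN
    · exact hJ.2.1 j hj
  · rw [Finset.image_insert, Finset.card_insert_of_notMem hiJ, Finset.card_insert_of_notMem hn,
      hJ.2.2.1]
  · rw [Finset.image_insert, Finset.card_insert_of_notMem haJ, Finset.card_insert_of_notMem hn,
      hJ.2.2.2]

/-- The number of down-sets of an order of the following kind: the elements of every antichain are
separated by their neighbourhoods in the comparability graph, and these neighbourhoods are convex
in the antichain with respect to a fixed linear order `L`. -/
theorem exists_card_downSets_le [Fintype X] (q L : X → X → Prop) [Std.Irrefl q]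
    [IsStrictTotalOrder X L]
    (hsep : ∀ a b, a ≠ b → ¬ Comp q a b → ∃ z, ¬ (Comp q z a ↔ Comp q z b))
    (hconv : ∀ a b c, ¬ Comp q a b → ¬ Comp q b c → ¬ Comp q a c → L a b → L b c → a ≠ c →
      ∀ z, Comp q z a → Comp q z c → Comp q z b) :
    ∃ m k j : ℕ, Fintype.card X = 2 * m + k ∧ j ≤ m ∧ j ≤ k ∧ k ≤ 2 * m + 1 ∧ k ≤ 3 * j + 1 ∧
      (downSets q Finset.univ).card ≤ 5 ^ j * 3 ^ (m - j) * 2 ^ (k - j) := by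
  classical
  obtain ⟨M, hM, hanti, haug⟩ := exists_maximum_matching q
  set A := (covered M)ᶜ with hA
  have hmA : ∀ a, a ∈ A ↔ a ∉ covered M := fun a => by simp [hA]
  let N : X × X → X → Prop := fun p a => Comp q p.1 a ∨ Comp q p.2 a
  have hNconv : ∀ p ∈ M, ∀ a ∈ A, ∀ b ∈ A, ∀ c ∈ A, L a b → L b c → N p a → N p c → N p b := by
    intro p hp a ha b hb c hc hab hbc h1 h2
    rw [hmA] at ha hb hc
    have hac : a ≠ c := by
      rintro rfl
      exact irrefl_of L a (trans_of L hab hbc)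
    have key := hconv a b c (hanti a ha b hb) (hanti b hb c hc) (hanti a ha c hc) hab hbc hac
    rcases h1 with h1 | h1 <;> rcases h2 with h2 | h2
    · exact Or.inl (key _ h1 h2)
    · exact absurd ⟨h1, h2⟩ (haug p hp a ha c hc hac)
    · exact absurd ⟨h2, h1⟩ (haug p hp c hc a ha hac.symm)
    · exact Or.inr (key _ h1 h2)
  have hsep' : ∀ a ∈ A, ∀ b ∈ A, ∀ z, Comp q z a → ¬ Comp q z b →
      ∃ p ∈ M, ¬ (N p a ↔ N p b) := by
    intro a ha b hb z hza hzb
    rw [hmA] at ha hb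
    have hab : a ≠ b := by
      rintro rfl
      exact hzb hza
    have hz : z ∈ covered M := by
      by_contra hz
      exact hanti z hz a ha hza
    obtain ⟨p, hp, rfl | rfl⟩ := mem_covered.1 hz
    · refine ⟨p, hp, fun h => ?_⟩
      rcases h.1 (Or.inl hza) with h' | h'
      · exact hzb h'
      · exact haug p hp a ha b hb hab ⟨hza, h'⟩
    · refine ⟨p, hp, fun h => ?_⟩
      rcases h.1 (Or.inr hza) with h' | h'
      · exact haug p hp b hb a ha hab.symm ⟨h', hza⟩
      · exact hzb h'
  have hNsep : ∀ a ∈ A, ∀ b ∈ A, a ≠ b → ∃ p ∈ M, ¬ (N p a ↔ N p b) := by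
    intro a ha b hb hab
    obtain ⟨z, hz⟩ := hsep a b hab (hanti a ((hmA a).1 ha) b ((hmA b).1 hb))
    by_cases hza : Comp q z a
    · exact hsep' a ha b hb z hza fun h => hz ⟨fun _ => h, fun _ => hza⟩
    · have hzb : Comp q z b := by
        by_contra h
        exact hz ⟨fun h' => absurd h' hza, fun h' => absurd h' h⟩
      obtain ⟨p, hp, h⟩ := hsep' b hb a ha z hzb hza
      exact ⟨p, hp, fun h' => h h'.symm⟩
  obtain ⟨J, hJ, hJN, hJ1, hJ2, hJmax⟩ := exists_maximal_representatives M A N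
  have hP : J.image Prod.fst ⊆ M := by
    intro p hp
    obtain ⟨j, hj, rfl⟩ := Finset.mem_image.1 hp
    exact (Finset.mem_product.1 (hJ hj)).1
  have hB : J.image Prod.snd ⊆ A := by
    intro p hp
    obtain ⟨j, hj, rfl⟩ := Finset.mem_image.1 hp
    exact (Finset.mem_product.1 (hJ hj)).2
  have hAcard : Fintype.card X = 2 * M.card + A.card := by
    rw [← card_covered hM, hA, Finset.card_compl, Nat.add_sub_cancel' (Finset.card_le_univ _)]
  have hJM : J.card ≤ M.card := hJ1 ▸ Finset.card_le_card hP
  have hJA : J.card ≤ A.card := hJ2 ▸ Finset.card_le_card hB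
  let := linearOrderOfSTO L
  have hk : A.card ≤ 2 * M.card + 1 := card_le_of_convex_of_separating A M N hNconv hNsep
  have hk' : (A \ J.image Prod.snd).card ≤ 2 * (J.image Prod.fst).card + 1 := by
    refine card_le_of_convex_of_separating _ _ N (fun p hp a ha b hb c hc => ?_)
      fun a ha b hb hab => ?_
    · exact hNconv p (hP hp) a (Finset.mem_sdiff.1 ha).1 b (Finset.mem_sdiff.1 hb).1 c
        (Finset.mem_sdiff.1 hc).1
    · rw [Finset.mem_sdiff] at ha hb
      obtain ⟨p, hp, h⟩ := hNsep a ha.1 b hb.1 hab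
      -- a pair without a representative has no neighbour among the elements left over
      refine ⟨p, ?_, h⟩
      by_contra hpJ
      exact h ⟨fun h' => absurd (hJmax p hp hpJ a ha.1 h') ha.2,
        fun h' => absurd (hJmax p hp hpJ b hb.1 h') hb.2⟩
  rw [Finset.card_sdiff_of_subset hB, hJ1, hJ2] at hk'
  refine ⟨M.card, A.card, J.card, hAcard, hJM, hJA, hk, by omega, ?_⟩
  have hcov : (Finset.univ : Finset X) =
      J.biUnion (fun j => {j.1.1, j.1.2, j.2}) ∪
        (M \ J.image Prod.fst).biUnion (fun p => {p.1, p.2}) ∪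
          (A \ J.image Prod.snd).biUnion (fun a => {a}) := by
    refine (Finset.eq_univ_of_forall fun x => ?_).symm
    simp only [Finset.mem_union, Finset.mem_biUnion, Finset.mem_insert, Finset.mem_singleton]
    by_cases hx : x ∈ A
    · by_cases hxJ : x ∈ J.image Prod.snd
      · obtain ⟨j, hj, rfl⟩ := Finset.mem_image.1 hxJ
        exact Or.inl (Or.inl ⟨j, hj, by simp⟩)
      · exact Or.inr ⟨x, Finset.mem_sdiff.2 ⟨hx, hxJ⟩, rfl⟩
    · rw [hmA, not_not] at hx
      obtain ⟨p, hp, hxp⟩ := mem_covered.1 hx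
      by_cases hpJ : p ∈ J.image Prod.fst
      · obtain ⟨j, hj, rfl⟩ := Finset.mem_image.1 hpJ
        exact Or.inl (Or.inl ⟨j, hj, hxp.imp_right Or.inl⟩)
      · exact Or.inl (Or.inr ⟨p, Finset.mem_sdiff.2 ⟨hp, hpJ⟩, hxp⟩)
  rw [hcov]
  refine (card_downSets_union_le _ _ _).trans (Nat.mul_le_mul
    ((card_downSets_union_le _ _ _).trans (Nat.mul_le_mul ?_ ?_)) ?_)
  · refine card_downSets_biUnion_le q J _ 5 fun j hj => ?_
    have hjM := (Finset.mem_product.1 (hJ hj)).1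
    have hjA := (hmA _).1 (Finset.mem_product.1 (hJ hj)).2
    have h1 := hM.1 _ hjM
    have hne1 : j.1.1 ≠ j.2 := fun h => hjA (mem_covered.2 ⟨_, hjM, Or.inl h.symm⟩)
    have hne2 : j.1.2 ≠ j.2 := fun h => hjA (mem_covered.2 ⟨_, hjM, Or.inr h.symm⟩)
    rcases hJN j hj with h | h
    · exact card_downSets_triple_le h1 h hne2
    · rw [Finset.insert_comm]
      exact card_downSets_triple_le h1.symm h hne1
  · rw [← hJ1, ← Finset.card_sdiff_of_subset hP]
    exact card_downSets_biUnion_le q _ _ 3 fun p hp =>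
      card_downSets_pair_le (hM.1 p (Finset.mem_sdiff.1 hp).1)
  · rw [← hJ2, ← Finset.card_sdiff_of_subset hB]
    exact card_downSets_biUnion_le q _ _ 2 fun a _ => by simpa using card_downSets_le q {a}

end Matchings

/-- The constant `1.81` may be split as `1.81 * 1.0445 * 1.062 > 2`: the second factor is paid for
by `k ≤ 2 * m + 1`, as `3 * 1.0445 ^ 2 < 1.81 ^ 2`, and the third one by `k ≤ 3 * j + 1`, as
`5 * 1.062 ^ 3 < 6`. -/
theorem packing_bound {m k j : ℕ} (hjm : j ≤ m) (hjk : j ≤ k) (h1 : k ≤ 2 * m + 1)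
    (h2 : k ≤ 3 * j + 1) :
    (5 ^ j * 3 ^ (m - j) * 2 ^ (k - j) : ℝ) ≤ 2 * 1.81 ^ (2 * m + k) := by
  have e1 : (5 ^ j * 3 ^ (m - j) * 2 ^ (k - j) : ℝ) = 3 ^ m * 2 ^ k * (5 / 6) ^ j := by
    obtain ⟨m, rfl⟩ := Nat.exists_eq_add_of_le hjm
    obtain ⟨k, rfl⟩ := Nat.exists_eq_add_of_le hjk
    rw [Nat.add_sub_cancel_left, Nat.add_sub_cancel_left, pow_add, pow_add, div_pow,
      show (6 : ℝ) = 3 * 2 by norm_num, mul_pow]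
    field_simp
  have e2 : (2 : ℝ) ^ k ≤ 1.81 ^ k * (1.0445 * (1.0445 ^ 2) ^ m) * (1.062 * (1.062 ^ 3) ^ j) := by
    calc (2 : ℝ) ^ k ≤ (1.81 * 1.0445 * 1.062) ^ k := by gcongr; norm_num
      _ = 1.81 ^ k * 1.0445 ^ k * 1.062 ^ k := by rw [mul_pow, mul_pow]
      _ ≤ 1.81 ^ k * 1.0445 ^ (2 * m + 1) * 1.062 ^ (3 * j + 1) := by
        gcongr <;> norm_num
      _ = _ := by rw [pow_succ' _ (2 * m), pow_succ' _ (3 * j), pow_mul, pow_mul]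
  calc (5 ^ j * 3 ^ (m - j) * 2 ^ (k - j) : ℝ) = 3 ^ m * 2 ^ k * (5 / 6) ^ j := e1
    _ ≤ 3 ^ m * (1.81 ^ k * (1.0445 * (1.0445 ^ 2) ^ m) * (1.062 * (1.062 ^ 3) ^ j))
        * (5 / 6) ^ j := by gcongr
    _ = 1.0445 * 1.062 * 1.81 ^ k * (3 * 1.0445 ^ 2) ^ m * (1.062 ^ 3 * (5 / 6)) ^ j := by
        rw [mul_pow 3, mul_pow (1.062 ^ 3)]
        ring
    _ ≤ 2 * 1.81 ^ k * (1.81 ^ 2) ^ m * 1 ^ j := by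
        gcongr <;> norm_num
    _ = 2 * 1.81 ^ (2 * m + k) := by rw [pow_add, pow_mul]; ring

/-! ### Two-dimensional orders -/

section TwoDimensional

theorem exists_realizer_pair {X : Type*} {r : X → X → Prop} [IsStrictOrder X r]
    (h : posetDim r ≤ 2) :
    ∃ L₀ L₁ : X → X → Prop, IsStrictTotalOrder X L₀ ∧ IsStrictTotalOrder X L₁ ∧
      ∀ x y, r x y ↔ L₀ x y ∧ L₁ x y := by
  have : ∃ d ≤ 2, ∃ L : Fin d → X → X → Prop, IsRealizer r L := by
    by_contra hc
    push Not at hc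
    have h3 : (3 : ℕ∞) ≤ posetDim r := by
      refine le_iInf₂ fun d ⟨L, hL⟩ => ?_
      by_contra hd
      have : d ≤ 2 := by
        have hd' : (d : ℕ∞) < (3 : ℕ) := not_le.1 hd
        have := Nat.cast_lt.1 hd'
        omega
      exact hc d this L hL
    exact absurd (h3.trans h) (by decide)
  obtain ⟨d, hd, L, hL, hr⟩ := this
  interval_cases d
  · -- the empty intersection is irreflexive only on the empty set
    have : IsEmpty X := ⟨fun x => irrefl_of r x ((hr x x).2 fun k => k.elim0)⟩
    have hs : IsStrictTotalOrder X r :=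
      { trichotomous := fun x => isEmptyElim x }
    exact ⟨r, r, hs, hs, fun x => isEmptyElim x⟩
  · exact ⟨L 0, L 0, hL 0, hL 0, fun x y => by simp [hr]⟩
  · exact ⟨L 0, L 1, hL 0, hL 1, fun x y => by simp [hr, Fin.forall_fin_two]⟩

variable {X : Type*} [LinearOrder X] {r : X → X → Prop}

theorem not_twin_of_not_comp {a b : X} (hab : a ≠ b) (h : ¬ Comp (chainTwins r) a b) :
    ¬ Twin r a b := by
  intro ht
  rcases lt_or_gt_of_ne hab with hl | hl
  · exact h (Or.inl (Or.inr ⟨ht, hl⟩))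
  · exact h (Or.inr (Or.inr ⟨ht.symm, hl⟩))

theorem not_rel_of_not_comp {a b : X} (h : ¬ Comp (chainTwins r) a b) : ¬ r a b ∧ ¬ r b a :=
  ⟨fun h' => h (Or.inl (Or.inl h')), fun h' => h (Or.inr (Or.inl h'))⟩

theorem comp_chainTwins_cases {a b : X} (h : Comp (chainTwins r) a b) :
    r a b ∨ r b a ∨ Twin r a b := by
  rcases h with (h | h) | (h | h)
  · exact Or.inl h
  · exact Or.inr (Or.inr h.1)
  · exact Or.inr (Or.inl h)
  · exact Or.inr (Or.inr h.1.symm)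

variable [IsStrictOrder X r]

instance chainTwins.irrefl : Std.Irrefl (chainTwins r) :=
  ⟨fun x h => h.elim (irrefl_of r x) fun h' => lt_irrefl x h'.2⟩

/-- Elements that are incomparable after twins have been chained up are not twins, so they have
different neighbours. -/
theorem exists_separating_of_not_comp {a b : X} (hab : a ≠ b)
    (h : ¬ Comp (chainTwins r) a b) :
    ∃ z, ¬ (Comp (chainTwins r) z a ↔ Comp (chainTwins r) z b) := by
  have key : ∀ {a b : X}, ¬ Comp (chainTwins r) a b → ∀ z, (r a z ∧ ¬ r b z) ∨ (r z a ∧ ¬ r z b) →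
      Comp (chainTwins r) z a ∧ ¬ Comp (chainTwins r) z b := by
    intro a b h z hz
    obtain ⟨h1, h2⟩ := not_rel_of_not_comp h
    rcases hz with ⟨hz, hz'⟩ | ⟨hz, hz'⟩
    · refine ⟨Or.inr (Or.inl hz), fun hc => ?_⟩
      rcases comp_chainTwins_cases hc with hc | hc | hc
      · exact h1 (trans_of r hz hc)
      · exact hz' hc
      · exact h1 ((hc a).2.1 hz)
    · refine ⟨Or.inl (Or.inl hz), fun hc => ?_⟩
      rcases comp_chainTwins_cases hc with hc | hc | hc
      · exact hz' hc
      · exact h2 (trans_of r hc hz)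
      · exact h2 ((hc a).1.1 hz)
  have hnt := not_twin_of_not_comp hab h
  simp only [Twin, not_forall] at hnt
  obtain ⟨z, hz⟩ := hnt
  refine ⟨z, fun hiff => ?_⟩
  by_cases h1 : (r a z ∧ ¬ r b z) ∨ (r z a ∧ ¬ r z b)
  · obtain ⟨h2, h3⟩ := key h z h1
    exact h3 (hiff.1 h2)
  · obtain ⟨h2, h3⟩ := key (fun hc => h hc.symm) z (by tauto)
    exact h3 (hiff.2 h2)

/-- In an antichain, ordered by the first of two realizers, the second one is reversed; hence the
elements above, or below, a given one are consecutive. -/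
theorem comp_of_between {L₀ L₁ : X → X → Prop} [IsStrictTotalOrder X L₀]
    [IsStrictTotalOrder X L₁] (hr : ∀ x y, r x y ↔ L₀ x y ∧ L₁ x y) {a b c : X}
    (hab : ¬ Comp (chainTwins r) a b) (hbc : ¬ Comp (chainTwins r) b c)
    (hac : ¬ Comp (chainTwins r) a c) (h₁ : L₀ a b) (h₂ : L₀ b c) (hne : a ≠ c) {z : X}
    (hza : Comp (chainTwins r) z a) (hzc : Comp (chainTwins r) z c) :
    Comp (chainTwins r) z b := by
  have hrev : ∀ {x y : X}, ¬ Comp (chainTwins r) x y → L₀ x y → L₁ y x := by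
    intro x y h hL
    rcases trichotomous_of L₁ x y with h' | h' | h'
    · exact absurd ((hr x y).2 ⟨hL, h'⟩) (not_rel_of_not_comp h).1
    · exact absurd (h' ▸ hL) (irrefl_of L₀ x)
    · exact h'
  have hba := hrev hab h₁
  have hcb := hrev hbc h₂
  obtain ⟨hac1, hac2⟩ := not_rel_of_not_comp hac
  have hnt := not_twin_of_not_comp hne hac
  rcases comp_chainTwins_cases hza with ha | ha | ha <;>
    rcases comp_chainTwins_cases hzc with hc | hc | hc
  · exact Or.inl (Or.inl ((hr z b).2 ⟨trans_of L₀ ((hr z a).1 ha).1 h₁,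
      trans_of L₁ ((hr z c).1 hc).2 hcb⟩))
  · exact absurd (trans_of r hc ha) hac2
  · exact absurd ((hc a).1.1 ha) hac2
  · exact absurd (trans_of r ha hc) hac1
  · exact Or.inr (Or.inl ((hr b z).2 ⟨trans_of L₀ h₂ ((hr c z).1 hc).1,
      trans_of L₁ hba ((hr a z).1 ha).2⟩))
  · exact absurd ((hc a).2.1 ha) hac1
  · exact absurd ((ha c).1.1 hc) hac1
  · exact absurd ((ha c).2.1 hc) hac2
  · exact absurd (ha.symm.trans hc) hnt

theorem card_downSets_chainTwins_le [Fintype X] (h : posetDim r ≤ 2) :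
    ((downSets (chainTwins r) Finset.univ).card : ℝ) ≤ 2 * 1.81 ^ Fintype.card X := by
  obtain ⟨L₀, L₁, hL₀, hL₁, hr⟩ := exists_realizer_pair h
  obtain ⟨m, k, j, hn, hjm, hjk, h1, h2, hc⟩ := exists_card_downSets_le (chainTwins r) L₀
    (fun a b => exists_separating_of_not_comp)
    (fun a b c hab hbc hac h₁ h₂ hne z => comp_of_between hr hab hbc hac h₁ h₂ hne)
  rw [hn]
  exact (by exact_mod_cast hc : _ ≤ (5 ^ j * 3 ^ (m - j) * 2 ^ (k - j) : ℝ)).trans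
    (packing_bound hjm hjk h1 h2)

end TwoDimensional

/-! ### Reasoning about programs and their cost -/

namespace RAM

/-- All numbers in the store have at most `W` binary digits. -/
def Store.Small (W : ℕ) (s : Store) : Prop :=
  (∀ x, (s.var x).size ≤ W) ∧ ∀ a i, (s.arr a i).size ≤ W

/-- The weight of an expression: a bound for the digits of its value and, after squaring, for its
cost, in units that depend on the digits of the numbers in the store only. -/
def Exp.wt : Exp → ℕ
  | .lit c => 1 + c.size
  | .var _ => 1
  | .get _ i => i.wt + 2
  | .bin _ e₁ e₂ => e₁.wt + e₂.wt + 1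

theorem Op.size_eval_le (o : Op) (a b : ℕ) : (o.eval a b).size ≤ a.size + b.size + 1 := by
  have ha := Nat.lt_size_self a
  have hb := Nat.lt_size_self b
  have h01 : ∀ p : Prop, [Decidable p] → (if p then 1 else 0 : ℕ).size ≤ a.size + b.size + 1 := by
    intro p _
    split_ifs <;> simp
  cases o
  · rw [Op.eval, Nat.size_le]
    have h1 : 2 ^ a.size ≤ 2 ^ (a.size + b.size) := Nat.pow_le_pow_right (by simp) (by omega)
    have h2 : 2 ^ b.size ≤ 2 ^ (a.size + b.size) := Nat.pow_le_pow_right (by simp) (by omega)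
    rw [pow_succ]
    omega
  · exact (Nat.size_le_size (Nat.sub_le a b)).trans (by omega)
  · rw [Op.eval, Nat.size_le]
    calc a * b < 2 ^ a.size * 2 ^ b.size := Nat.mul_lt_mul'' ha hb
      _ = 2 ^ (a.size + b.size) := (pow_add _ _ _).symm
      _ ≤ _ := Nat.pow_le_pow_right (by simp) (by omega)
  · exact (Nat.size_le_size (Nat.div_le_self a b)).trans (by omega)
  · exact (Nat.size_le_size (Nat.mod_le a b)).trans (by omega)
  · exact h01 _
  · exact h01 _

theorem Op.cost_le (o : Op) (a b : ℕ) : o.cost a b ≤ (1 + a.size) * (1 + b.size) := by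
  have : 1 + a.size + b.size ≤ (1 + a.size) * (1 + b.size) := by nlinarith
  cases o <;> first | exact le_rfl | exact this

theorem Exp.size_eval_le {W : ℕ} {s : Store} (hs : s.Small W) (e : Exp) :
    (e.eval s).size ≤ e.wt * (1 + W) := by
  induction e with
  | lit c => simp only [Exp.eval, Exp.wt]; nlinarith
  | var x => simp only [Exp.eval, Exp.wt]; have := hs.1 x; omega
  | get a i ih => simp only [Exp.eval, Exp.wt]; have := hs.2 a (i.eval s); nlinarith
  | bin o e₁ e₂ ih₁ ih₂ =>
    simp only [Exp.eval, Exp.wt]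
    have := o.size_eval_le (e₁.eval s) (e₂.eval s)
    nlinarith

theorem Exp.cost_le {W : ℕ} {s : Store} (hs : s.Small W) (e : Exp) :
    e.cost s ≤ e.wt ^ 2 * (1 + W) ^ 2 := by
  induction e with
  | lit c =>
    simp only [Exp.cost, Exp.wt]
    calc 1 + c.size ≤ (1 + c.size) ^ 2 := Nat.le_self_pow (by simp) _
      _ ≤ _ := Nat.le_mul_of_pos_right _ (by positivity)
  | var x =>
    simp only [Exp.cost, Exp.wt]
    have := hs.1 x
    nlinarith
  | get a i ih =>
    simp only [Exp.cost, Exp.wt]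
    have h1 := hs.2 a (i.eval s)
    have h2 := i.size_eval_le hs
    have h3 : i.wt * (1 + W) ≤ i.wt * (1 + W) ^ 2 := by gcongr; nlinarith
    nlinarith
  | bin o e₁ e₂ ih₁ ih₂ =>
    simp only [Exp.cost, Exp.wt]
    have h1 := e₁.size_eval_le hs
    have h2 := e₂.size_eval_le hs
    have h3 : o.cost (e₁.eval s) (e₂.eval s) ≤ (1 + e₁.wt * (1 + W)) * (1 + e₂.wt * (1 + W)) :=
      (o.cost_le _ _).trans (by gcongr)
    have h4 : e₁.wt * (1 + W) ≤ e₁.wt * (1 + W) ^ 2 := by gcongr; nlinarith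
    have h5 : e₂.wt * (1 + W) ≤ e₂.wt * (1 + W) ^ 2 := by gcongr; nlinarith
    nlinarith [Nat.zero_le (e₁.wt * e₂.wt * (1 + W) ^ 2)]

theorem Store.var_setVar (s : Store) (x v y : ℕ) :
    (s.setVar x v).var y = if y = x then v else s.var y := by
  simp [Store.setVar, Function.update_apply]

theorem Store.arr_setVar (s : Store) (x v : ℕ) : (s.setVar x v).arr = s.arr := rfl

theorem Store.var_setArr (s : Store) (a i v : ℕ) : (s.setArr a i v).var = s.var := rfl

theorem Store.arr_setArr (s : Store) (a i v b j : ℕ) :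
    (s.setArr a i v).arr b j = if b = a ∧ j = i then v else s.arr b j := by
  simp only [Store.setArr, Function.update_apply]
  split_ifs <;> simp_all

theorem Store.Small.setVar {W : ℕ} {s : Store} (hs : s.Small W) {x v : ℕ} (hv : v < 2 ^ W) :
    (s.setVar x v).Small W := by
  refine ⟨fun y => ?_, hs.2⟩
  rw [Store.var_setVar]
  split_ifs
  exacts [Nat.size_le.2 hv, hs.1 y]

theorem Store.Small.setArr {W : ℕ} {s : Store} (hs : s.Small W) {a i v : ℕ} (hv : v < 2 ^ W) :
    (s.setArr a i v).Small W := by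
  refine ⟨hs.1, fun b j => ?_⟩
  rw [Store.arr_setArr]
  split_ifs
  exacts [Nat.size_le.2 hv, hs.2 b j]

/-- Started in `s`, the program `p` halts in a store with the property `Q`, and all stored numbers
keep at most `W` digits; the cost is at most `t` units of `(1 + W) ^ 2`. -/
def Run (W : ℕ) (p : Prog) (s : Store) (t : ℕ) (Q : Store → Prop) : Prop :=
  s.Small W → ∃ t' s', Exec p s t' s' ∧ t' ≤ t * (1 + W) ^ 2 ∧ s'.Small W ∧ Q s'

theorem Run.mono {W : ℕ} {p : Prog} {s : Store} {t t' : ℕ} {Q Q' : Store → Prop}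
    (h : Run W p s t Q) (ht : t ≤ t') (hQ : ∀ s', Q s' → Q' s') : Run W p s t' Q' := by
  intro hs
  obtain ⟨u, s', h1, h2, h3, h4⟩ := h hs
  exact ⟨u, s', h1, h2.trans (by gcongr), h3, hQ s' h4⟩

theorem Run.seq {W : ℕ} {p p' : Prog} {s : Store} {t t' : ℕ} {Q : Store → Prop}
    (h : Run W p s t fun s' => Run W p' s' t' Q) : Run W (.seq p p') s (t + t') Q := by
  intro hs
  obtain ⟨u, s', h1, h2, h3, h4⟩ := h hs
  obtain ⟨u', s'', h1', h2', h3', h4'⟩ := h4 h3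
  exact ⟨u + u', s'', h1.seq h1', by rw [add_mul]; omega, h3', h4'⟩

/-- A bound for the cost of a program without loops, in the units of `Run`; the value at a loop has
no meaning. -/
def Prog.wt : Prog → ℕ
  | .skip => 1
  | .assign _ e => e.wt ^ 2 + 1 + e.wt
  | .put _ i e => i.wt ^ 2 + e.wt ^ 2 + 1 + i.wt + e.wt
  | .seq p q => p.wt + q.wt
  | .ite e p q => e.wt ^ 2 + 1 + p.wt + q.wt
  | .loop _ _ => 0

/-- Preconditions of programs without loops, which also keep all assigned values below `2 ^ W`; a
loop gets the precondition `False`. -/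
def Prog.wp (W : ℕ) : Prog → (Store → Prop) → Store → Prop
  | .skip, Q, s => Q s
  | .assign x e, Q, s => e.eval s < 2 ^ W ∧ Q (s.setVar x (e.eval s))
  | .put a i e, Q, s => e.eval s < 2 ^ W ∧ Q (s.setArr a (i.eval s) (e.eval s))
  | .seq p q, Q, s => p.wp W (q.wp W Q) s
  | .ite e p q, Q, s => (e.eval s ≠ 0 → p.wp W Q s) ∧ (e.eval s = 0 → q.wp W Q s)
  | .loop _ _, _, _ => False

theorem Run.of_wp {W : ℕ} {p : Prog} {s : Store} {Q : Store → Prop} (h : p.wp W Q s) :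
    Run W p s p.wt Q := by
  induction p generalizing s Q with
  | skip => exact fun hs => ⟨1, s, .skip s, by
    simpa [Prog.wt] using Nat.one_le_pow 2 (1 + W) (by omega), hs, h⟩
  | assign x e =>
    intro hs
    have h1 := e.cost_le hs
    have h2 := e.size_eval_le hs
    have h3 : e.wt * (1 + W) ≤ e.wt * (1 + W) ^ 2 := by gcongr; nlinarith
    exact ⟨_, _, .assign x e s, by simp only [Prog.wt]; nlinarith, hs.setVar h.1, h.2⟩
  | put a i e =>
    intro hs
    have h1 := e.cost_le hs
    have h2 := e.size_eval_le hs
    have h3 : e.wt * (1 + W) ≤ e.wt * (1 + W) ^ 2 := by gcongr; nlinarith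
    have h1' := i.cost_le hs
    have h2' := i.size_eval_le hs
    have h3' : i.wt * (1 + W) ≤ i.wt * (1 + W) ^ 2 := by gcongr; nlinarith
    exact ⟨_, _, .put a i e s, by simp only [Prog.wt]; nlinarith, hs.setArr h.1, h.2⟩
  | seq p q ihp ihq =>
    exact Run.seq ((ihp h).mono le_rfl fun s' h' => ihq h')
  | ite e p q ihp ihq =>
    intro hs
    have h1 := e.cost_le hs
    have h2 : 1 ≤ (1 + W) ^ 2 := Nat.one_le_pow _ _ (by omega)
    by_cases he : e.eval s = 0
    · obtain ⟨u, s', h3, h4, h5⟩ := ihq (h.2 he) hs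
      exact ⟨_, s', .iteFalse he h3, by simp only [Prog.wt]; nlinarith, h5⟩
    · obtain ⟨u, s', h3, h4, h5⟩ := ihp (h.1 he) hs
      exact ⟨_, s', .iteTrue he h3, by simp only [Prog.wt]; nlinarith, h5⟩
  | loop e p => exact h.elim

/-- Loops: `I k` holds after `k` iterations, of which there are at most `N`. -/
theorem Run.loop {W : ℕ} {e : Exp} {p : Prog} {N t : ℕ} (I : ℕ → Store → Prop)
    (h : ∀ k s, I k s → e.eval s ≠ 0 → k < N ∧ Run W p s t (I (k + 1))) {s : Store} (hI : I 0 s) :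
    Run W (.loop e p) s ((N + 1) * (e.wt ^ 2 + 1 + t)) fun s' => ∃ k, I k s' ∧ e.eval s' = 0 := by
  have h0 : ∀ d (s : Store), s.Small W →
      e.cost s + 1 ≤ (d + 1) * (e.wt ^ 2 + 1 + t) * (1 + W) ^ 2 := by
    intro d s hs
    have h1 := e.cost_le hs
    have h2 : 1 ≤ (1 + W) ^ 2 := Nat.one_le_pow _ _ (by omega)
    have h3 : e.cost s + 1 ≤ (e.wt ^ 2 + 1 + t) * (1 + W) ^ 2 := by nlinarith
    exact h3.trans (Nat.mul_le_mul_right _ (Nat.le_mul_of_pos_left _ (by omega)))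
  have key : ∀ d k s, N - k = d → I k s → Run W (.loop e p) s ((d + 1) * (e.wt ^ 2 + 1 + t))
      fun s' => ∃ k, I k s' ∧ e.eval s' = 0 := by
    intro d
    induction d with
    | zero =>
      intro k s hd hI hs
      by_cases he : e.eval s = 0
      · exact ⟨_, s, .loopFalse he, h0 0 s hs, hs, k, hI, he⟩
      · have := (h k s hI he).1
        omega
    | succ d ih =>
      intro k s hd hI hs
      have h1 := e.cost_le hs
      have h2 : 1 ≤ (1 + W) ^ 2 := Nat.one_le_pow _ _ (by omega)
      by_cases he : e.eval s = 0
      · exact ⟨_, s, .loopFalse he, h0 _ s hs, hs, k, hI, he⟩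
      · obtain ⟨u, s', h3, h4, h5, h6⟩ := (h k s hI he).2 hs
        obtain ⟨u', s'', h3', h4', h5'⟩ := ih (k + 1) s' (by omega) h6 h5
        exact ⟨_, s'', .loopTrue he h3 h3', by nlinarith, h5'⟩
  exact (key _ 0 s rfl hI).mono (by simp) fun _ => id

/-- Loops with exactly `N` iterations. -/
theorem Run.for {W : ℕ} {e : Exp} {p : Prog} {N t : ℕ} (I : ℕ → Store → Prop)
    (he : ∀ k s, I k s → (e.eval s ≠ 0 ↔ k < N))
    (h : ∀ k < N, ∀ s, I k s → Run W p s t (I (k + 1))) {s : Store} (hI : I 0 s) :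
    Run W (.loop e p) s ((N + 1) * (e.wt ^ 2 + 1 + t)) (I N) := by
  refine (Run.loop (N := N) (t := t) (fun k s => k ≤ N ∧ I k s) (fun k s hk h0 => ?_)
    ⟨Nat.zero_le _, hI⟩).mono le_rfl ?_
  · have hkN := (he k s hk.2).1 h0
    exact ⟨hkN, (h k hkN s hk.2).mono le_rfl fun s' h' => ⟨hkN, h'⟩⟩
  · rintro s' ⟨k, ⟨hk, hI'⟩, h0⟩
    have : ¬ k < N := fun h => (he k s' hI').2 h h0
    obtain rfl : k = N := by omega
    exact hI'

end RAM

/-! ### The breadth-first search through the down-sets -/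

section Search

variable {X : Type*} [Fintype X] [LinearOrder X] {r : X → X → Prop}

open Classical in
/-- The number of twins of `x` outside of `D`. -/
noncomputable def twinsOutside (r : X → X → Prop) (D : Finset X) (x : X) : ℕ :=
  (Finset.univ.filter fun y => y ∉ D ∧ Twin r x y).card

theorem twinsOutside_pos {D : Finset X} {x : X} (hx : x ∉ D) : 0 < twinsOutside r D x :=
  Finset.card_pos.2 ⟨x, by simp [hx, Twin.refl]⟩

theorem mem_minimals_compl {q : X → X → Prop} {D : Finset X} {x : X} :
    x ∈ minimals q Dᶜ ↔ x ∉ D ∧ ∀ y ∉ D, ¬ q y x := by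
  simp [mem_minimals]

theorem extCount_compl_eq_sum [Std.Irrefl r] {D : Finset X} (hD : D ≠ Finset.univ) :
    extCount r Dᶜ = ∑ x ∈ minimals (chainTwins r) Dᶜ,
      twinsOutside r D x * extCount r (insert x D)ᶜ := by
  rw [extCount_eq_sum_chainTwins (by
    rwa [Finset.nonempty_iff_ne_empty, ne_eq, Finset.compl_eq_empty_iff])]
  refine Finset.sum_congr rfl fun x _ => ?_
  rw [Finset.compl_insert, twinsOutside]
  congr 2
  ext y
  simp

theorem insert_mem_downSets {q : X → X → Prop} {D : Finset X} {x : X}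
    (hD : D ∈ downSets q Finset.univ) (hx : x ∈ minimals q Dᶜ) :
    insert x D ∈ downSets q Finset.univ := by
  rw [mem_minimals_compl] at hx
  refine mem_downSets.2 ⟨Finset.subset_univ _, fun y hy z _ hzy => ?_⟩
  rcases Finset.mem_insert.1 hy with rfl | hy
  · by_contra hz
    exact hx.2 z (fun h => hz (Finset.mem_insert_of_mem h)) hzy
  · exact Finset.mem_insert_of_mem ((mem_downSets.1 hD).2 y hy z (Finset.mem_univ _) hzy)

/-- The queue of a breadth-first search: the first `t` values of `q` are the down-sets found so
far, ordered by cardinality, and the first `h` of them have been processed. `F` is the table of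
the numbers of paths found so far, which also tells whether a set has been found. -/
structure IsQueue (r : X → X → Prop) (h t : ℕ) (q : ℕ → Finset X) (F : Finset X → ℕ) : Prop where
  down : ∀ i < t, q i ∈ downSets (chainTwins r) Finset.univ
  inj : ∀ i < t, ∀ j < t, q i = q j → i = j
  mono : ∀ i j, i ≤ j → j < t → (q i).card ≤ (q j).card
  near : ∀ i < t, ∀ j < t, h ≤ j → (q i).card ≤ (q j).card + 1
  supp : ∀ S, F S ≠ 0 ↔ ∃ i < t, q i = S

/-- The number of linear extensions that are still to be counted: each path to a waiting down-set
continues in as many ways as its complement has linear extensions. -/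
noncomputable def pending (r : X → X → Prop) (h t : ℕ) (q : ℕ → Finset X) (F : Finset X → ℕ) : ℕ :=
  ∑ i ∈ Finset.Ico h t, F (q i) * extCount r (q i)ᶜ

theorem IsQueue.succ {h t : ℕ} {q : ℕ → Finset X} {F : Finset X → ℕ} (H : IsQueue r h t q F) :
    IsQueue r (h + 1) t q F :=
  { H with near := fun i hi j hj hij => H.near i hi j hj (by omega) }

theorem IsQueue.length_le {h t : ℕ} {q : ℕ → Finset X} {F : Finset X → ℕ}
    (H : IsQueue r h t q F) : t ≤ (downSets (chainTwins r) Finset.univ).card := by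
  rw [← Finset.card_range t]
  exact Finset.card_le_card_of_injOn q (fun i hi => H.down i (Finset.mem_range.1 hi))
    fun i hi j hj => H.inj i (Finset.mem_range.1 hi) j (Finset.mem_range.1 hj)

theorem le_pending [IsStrictOrder X r] {h t i : ℕ} {q : ℕ → Finset X} {F : Finset X → ℕ}
    (hi : h ≤ i) (hit : i < t) : F (q i) ≤ pending r h t q F :=
  (Nat.le_mul_of_pos_right _ (extCount_pos r _)).trans
    (Finset.single_le_sum (f := fun i => F (q i) * extCount r (q i)ᶜ) (fun _ _ => Nat.zero_le _)
      (Finset.mem_Ico.2 ⟨hi, hit⟩))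

theorem IsQueue.push_found {h t c : ℕ} {q : ℕ → Finset X} {F : Finset X → ℕ}
    (H : IsQueue r h t q F) (ht : h < t) {x : X} (hx : x ∉ q h)
    (hF : F (insert x (q h)) ≠ 0) :
    IsQueue r h t q (Function.update F (insert x (q h)) (F (insert x (q h)) + c)) ∧
      (∃ i, h + 1 ≤ i ∧ i < t ∧ q i = insert x (q h)) ∧
      pending r (h + 1) t q (Function.update F (insert x (q h)) (F (insert x (q h)) + c)) =
        pending r (h + 1) t q F + c * extCount r (insert x (q h))ᶜ := by
  set E := insert x (q h) with hE
  obtain ⟨i, hi, hiE⟩ := (H.supp E).1 hF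
  have hih : h + 1 ≤ i := by
    by_contra hc
    have h1 := H.mono i h (by omega) ht
    rw [hiE, hE, Finset.card_insert_of_notMem hx] at h1
    omega
  refine ⟨{ H with supp := fun S => ?_ }, ⟨i, hih, hi, hiE⟩, ?_⟩
  · rw [← H.supp, Function.update_apply]
    split_ifs with hS
    · subst hS
      exact iff_of_true (by omega) hF
    · rfl
  · have hmem : i ∈ Finset.Ico (h + 1) t := Finset.mem_Ico.2 ⟨hih, hi⟩
    rw [pending, pending, ← Finset.add_sum_erase _ _ hmem, ← Finset.add_sum_erase _ _ hmem, hiE,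
      Function.update_self, add_mul]
    have : ∀ j ∈ (Finset.Ico (h + 1) t).erase i,
        Function.update F E (F E + c) (q j) * extCount r (q j)ᶜ =
          F (q j) * extCount r (q j)ᶜ := by
      intro j hj
      rw [Finset.mem_erase, Finset.mem_Ico] at hj
      rw [Function.update_of_ne]
      intro hc
      exact hj.1 (H.inj j hj.2.2 i hi (hc.trans hiE.symm))
    rw [Finset.sum_congr rfl this]
    ring

theorem IsQueue.push_new {h t c : ℕ} {q : ℕ → Finset X} {F : Finset X → ℕ}
    (H : IsQueue r h t q F) (ht : h < t) (hc : c ≠ 0) {x : X}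
    (hx : x ∈ minimals (chainTwins r) (q h)ᶜ) (hF : F (insert x (q h)) = 0) :
    IsQueue r h (t + 1) (Function.update q t (insert x (q h)))
        (Function.update F (insert x (q h)) (F (insert x (q h)) + c)) ∧
      pending r (h + 1) (t + 1) (Function.update q t (insert x (q h)))
          (Function.update F (insert x (q h)) (F (insert x (q h)) + c)) =
        pending r (h + 1) t q F + c * extCount r (insert x (q h))ᶜ := by
  have hcard : (insert x (q h)).card = (q h).card + 1 :=
    Finset.card_insert_of_notMem (mem_minimals_compl.1 hx).1
  have hdown := insert_mem_downSets (H.down h ht) hx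
  set E := insert x (q h) with hE
  have hn : ∀ i < t, q i ≠ E := fun i hi hiE => (H.supp E).2 ⟨i, hi, hiE⟩ hF
  have hq : ∀ i < t, Function.update q t E i = q i := fun i hi =>
    Function.update_of_ne (by omega) _ _
  have hqt : Function.update q t E t = E := Function.update_self _ _ _
  have hsplit : ∀ i, i < t + 1 → i < t ∨ i = t := fun i hi => by omega
  refine ⟨⟨?_, ?_, ?_, ?_, ?_⟩, ?_⟩
  · intro i hi
    rcases hsplit i hi with hi | rfl
    · rw [hq i hi]
      exact H.down i hi
    · rwa [hqt]
  · intro i hi j hj hij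
    rcases hsplit i hi with hi | rfl <;> rcases hsplit j hj with hj | rfl
    · rw [hq i hi, hq j hj] at hij
      exact H.inj i hi j hj hij
    · rw [hq i hi, hqt] at hij
      exact absurd hij (hn i hi)
    · rw [hq j hj, hqt] at hij
      exact absurd hij.symm (hn j hj)
    · rfl
  · intro i j hij hj
    rcases hsplit j hj with hj | rfl
    · rw [hq i (by omega), hq j hj]
      exact H.mono i j hij hj
    · rcases hsplit i (by omega) with hi | rfl
      · rw [hq i hi, hqt, hcard]
        exact H.near i hi h ht le_rfl
      · rfl
  · intro i hi j hj hhj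
    rcases hsplit i hi with hi | rfl <;> rcases hsplit j hj with hj | rfl
    · rw [hq i hi, hq j hj]
      exact H.near i hi j hj hhj
    · rw [hq i hi, hqt, hcard]
      exact (H.near i hi h ht le_rfl).trans (by omega)
    · rw [hq j hj, hqt, hcard]
      have := H.mono h j hhj hj
      omega
    · omega
  · intro S
    rw [Function.update_apply]
    split_ifs with hS
    · subst hS
      exact iff_of_true (by omega) ⟨t, by omega, hqt⟩
    · rw [H.supp]
      constructor
      · rintro ⟨i, hi, rfl⟩
        exact ⟨i, by omega, hq i hi⟩
      · rintro ⟨i, hi, rfl⟩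
        rcases hsplit i hi with hi | rfl
        · exact ⟨i, hi, (hq i hi).symm⟩
        · exact absurd hqt hS
  · rw [pending, pending, Finset.sum_Ico_succ_top (by omega), hqt, Function.update_self, hF,
      zero_add]
    congr 1
    refine Finset.sum_congr rfl fun i hi => ?_
    rw [Finset.mem_Ico] at hi
    rw [hq i hi.2, Function.update_of_ne (hn i hi.2)]

/-- The whole set comes last in the queue. -/
theorem IsQueue.eq_of_univ {h t : ℕ} {q : ℕ → Finset X} {F : Finset X → ℕ}
    (H : IsQueue r h t q F) (ht : h < t) (hu : q h = Finset.univ) : t = h + 1 := by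
  by_contra hc
  have h1 := H.mono h (h + 1) (by omega) (by omega)
  rw [hu, Finset.card_univ] at h1
  have h2 := Finset.eq_univ_of_card _ (le_antisymm (Finset.card_le_univ _) h1)
  have := H.inj h ht (h + 1) (by omega) (hu.trans h2.symm)
  omega

end Search

/-! ### Sets as binary numbers -/

/-- The number with the binary digits given by `S`. -/
def mask {n : ℕ} (S : Finset (Fin n)) : ℕ := ∑ i ∈ S, 2 ^ (i : ℕ)

theorem testBit_mask {n : ℕ} (S : Finset (Fin n)) (j : ℕ) :
    (mask S).testBit j = true ↔ ∃ i ∈ S, (i : ℕ) = j := by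
  rw [← Nat.mem_bitIndices, ← List.mem_toFinset,
    show mask S = ∑ i ∈ S.map Fin.valEmbedding, 2 ^ i by simp [mask],
    Finset.toFinset_bitIndices_sum_two_pow]
  simp

theorem mask_div_mod {n : ℕ} (S : Finset (Fin n)) (y : Fin n) [Decidable (y ∈ S)] :
    mask S / 2 ^ (y : ℕ) % 2 = if y ∈ S then 1 else 0 := by
  have h := testBit_mask S y
  rw [Nat.testBit_eq_decide_div_mod_eq, decide_eq_true_iff] at h
  have h' : (∃ i ∈ S, (i : ℕ) = y) ↔ y ∈ S :=
    ⟨fun ⟨i, hi, hy⟩ => Fin.ext hy ▸ hi, fun hy => ⟨y, hy, rfl⟩⟩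
  rw [h'] at h
  split_ifs with hy
  · exact h.2 hy
  · have := mt h.1 hy
    omega

theorem mask_injective (n : ℕ) : Function.Injective (mask (n := n)) := by
  intro S T h
  ext i
  have h1 := testBit_mask S i
  rw [h, testBit_mask] at h1
  constructor
  · intro hi
    obtain ⟨j, hj, h⟩ := h1.2 ⟨i, hi, rfl⟩
    exact Fin.ext h ▸ hj
  · intro hi
    obtain ⟨j, hj, h⟩ := h1.1 ⟨i, hi, rfl⟩
    exact Fin.ext h ▸ hj

theorem mask_insert {n : ℕ} {S : Finset (Fin n)} {x : Fin n} (hx : x ∉ S) :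
    mask (insert x S) = mask S + 2 ^ (x : ℕ) := by
  rw [mask, Finset.sum_insert hx, add_comm]
  rfl

theorem mask_lt {n : ℕ} (S : Finset (Fin n)) : mask S < 2 ^ n := by
  refine Nat.lt_pow_two_of_testBit _ fun j hj => ?_
  rw [← Bool.not_eq_true, testBit_mask]
  rintro ⟨i, -, rfl⟩
  omega

/-! ### The program -/

namespace RAM

/-- The entry in row `i` and column `j` of the matrix stored in the array `a`; the variable `0`
holds the number of columns. -/
def entry (a : ℕ) (i j : Exp) : Exp := .get a (.bin .add (.bin .mul i (.var 0)) j)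

/-- The variable `1` runs through the triples `(y, x, z)`, coded as `(y * n + x) * n + z`; the entry
`y * n + x` of the array `1` becomes `1` if `z` shows that `y` and `x` are not twins. -/
def twinStep : Prog :=
  let c : Exp := .bin .div (.var 1) (.var 0)
  let y : Exp := .bin .div c (.var 0)
  let x : Exp := .bin .mod c (.var 0)
  let z : Exp := .bin .mod (.var 1) (.var 0)
  .seq
    (.put 1 c (.bin .lt (.lit 0) (.bin .add (.get 1 c) (.bin .add
      (.bin .sub (.lit 1) (.bin .eq (entry 0 y z) (entry 0 x z)))
      (.bin .sub (.lit 1) (.bin .eq (entry 0 z y) (entry 0 z x)))))))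
    (.assign 1 (.bin .add (.var 1) (.lit 1)))

/-- The condition of the loop around `twinStep`. -/
def twinCond : Exp := .bin .lt (.var 1) (.bin .mul (.var 0) (.bin .mul (.var 0) (.var 0)))

/-- The set with the mask in the variable `5` is inspected at the element `y` in the variable `2`,
where the variable `11` holds `2 ^ y`.  If `y` is missing, the variable `7` is increased if `y` has
to precede the element `x` in the variable `1`, and the variable `8` if `y` is a twin of `x`. -/
def scanStep : Prog :=
  .seq (.assign 12 (.bin .sub (.lit 1) (.bin .mod (.bin .div (.var 5) (.var 11)) (.lit 2))))
  (.seq (.assign 7 (.bin .add (.var 7) (.bin .mul (.var 12) (.bin .add (entry 0 (.var 2) (.var 1))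
    (.bin .mul (.bin .sub (.lit 1) (entry 1 (.var 2) (.var 1))) (.bin .lt (.var 2) (.var 1)))))))
  (.seq (.assign 8 (.bin .add (.var 8) (.bin .mul (.var 12)
    (.bin .sub (.lit 1) (entry 1 (.var 2) (.var 1))))))
  (.seq (.assign 11 (.bin .add (.var 11) (.var 11)))
    (.assign 2 (.bin .add (.var 2) (.lit 1))))))

/-- The condition of the loop around `scanStep`. -/
def scanCond : Exp := .bin .lt (.var 2) (.var 0)

/-- The set in the variable `5`, which is reached by as many paths as the variable `6` says, is
extended by the element whose power of two is in the variable `10`; the variable `8` is the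
multiplicity of this step.  A new set is appended to the queue in the array `2`, the length of which
is in the variable `4`; the array `3` holds the numbers of paths. -/
def visit : Prog :=
  .seq (.assign 9 (.bin .add (.var 5) (.var 10)))
  (.seq (.ite (.get 3 (.var 9)) .skip
    (.seq (.put 2 (.var 4) (.var 9)) (.assign 4 (.bin .add (.var 4) (.lit 1)))))
    (.put 3 (.var 9) (.bin .add (.get 3 (.var 9)) (.bin .mul (.var 8) (.var 6)))))

/-- The initialization of the scan for the element `x` in the variable `1`.  The variable `7` counts
the obstacles to adding `x`; it starts with `1` if `x` is already present. -/
def scanInit : Prog :=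
  .seq (.assign 7 (.bin .mod (.bin .div (.var 5) (.var 10)) (.lit 2)))
    (.seq (.assign 8 (.lit 0)) (.seq (.assign 2 (.lit 0)) (.assign 11 (.lit 1))))

/-- The extension after the scan, and the transition to the next element. -/
def scanExit : Prog :=
  .seq (.ite (.var 7) .skip visit)
    (.seq (.assign 10 (.bin .add (.var 10) (.var 10)))
      (.assign 1 (.bin .add (.var 1) (.lit 1))))

/-- The treatment of one element. -/
def elementStep : Prog := .seq scanInit (.seq (.loop scanCond scanStep) scanExit)

/-- The condition of the loop around `elementStep`. -/
def elementCond : Exp := .bin .lt (.var 1) (.var 0)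

/-- The next set is taken from the queue; the variable `3` is its position. -/
def headInit : Prog :=
  .seq (.assign 5 (.get 2 (.var 3))) (.seq (.assign 6 (.get 3 (.var 5)))
    (.seq (.assign 1 (.lit 0)) (.assign 10 (.lit 1))))

/-- The treatment of one set in the queue. -/
def headStep : Prog :=
  .seq headInit (.seq (.loop elementCond elementStep)
    (.assign 3 (.bin .add (.var 3) (.lit 1))))

/-- The condition of the loop around `headStep`. -/
def headCond : Exp := .bin .lt (.var 3) (.var 4)

/-- The empty set is put into the queue. -/
def queueInit : Prog := .seq (.put 3 (.lit 0) (.lit 1)) (.assign 4 (.lit 1))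

/-- The program that counts linear extensions. -/
def countProg : Prog :=
  .seq (.loop twinCond twinStep) (.seq queueInit
    (.seq (.loop headCond headStep) (.assign 0 (.var 6))))

/-! ### Correctness of the program -/

variable {n : ℕ}

theorem index_lt (y x : Fin n) : (y : ℕ) * n + x < n * n := by
  have h1 := y.2
  have h2 := x.2
  nlinarith

theorem index_div (y x : Fin n) : ((y : ℕ) * n + x) / n = y := by
  rw [mul_comm, Nat.mul_add_div (by have := x.2; omega), Nat.div_eq_of_lt x.2, add_zero]

theorem index_mod (y x : Fin n) : ((y : ℕ) * n + x) % n = x := by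
  rw [mul_comm, Nat.mul_add_mod, Nat.mod_eq_of_lt x.2]

open Classical in
/-- The array `0` holds the matrix of `r`. -/
def HoldsRel (r : Fin n → Fin n → Prop) (s : Store) : Prop :=
  s.var 0 = n ∧ ∀ y x : Fin n, s.arr 0 (y * n + x) = if r y x then 1 else 0

open Classical in
/-- The array `1` holds the matrix of the complement of the relation `Twin r`. -/
def HoldsTwins (r : Fin n → Fin n → Prop) (s : Store) : Prop :=
  ∀ y x : Fin n, s.arr 1 (y * n + x) = if Twin r y x then 0 else 1

theorem holdsRel_input (r : Fin n → Fin n → Prop) : HoldsRel r (input r) := by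
  classical
  refine ⟨by simp [input], fun y x => ?_⟩
  simp only [input, true_and]
  congr 1
  refine propext ⟨?_, fun h => ⟨y, x, rfl, h⟩⟩
  rintro ⟨i, j, h, hr⟩
  have h1 := congrArg (· / n) h
  have h2 := congrArg (· % n) h
  simp only [index_div, index_mod] at h1 h2
  rwa [Fin.ext h1, Fin.ext h2]

theorem triple_lt (y x z : Fin n) : ((y : ℕ) * n + x) * n + z < n * (n * n) := by
  have h1 := index_lt y x
  have h2 := z.2
  nlinarith

theorem run_twinLoop {W : ℕ} {r : Fin n → Fin n → Prop} {s : Store} (hr : HoldsRel r s)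
    (h1 : s.var 1 = 0) (harr : ∀ i, s.arr 1 i = 0) (hW : n * (n * n) < 2 ^ W) :
    Run W (.loop twinCond twinStep) s ((n * (n * n) + 1) * (twinCond.wt ^ 2 + 1 + twinStep.wt))
      fun s' => HoldsRel r s' ∧ HoldsTwins r s' ∧ (∀ v, v ≠ 1 → s'.var v = s.var v) ∧
        ∀ a, a ≠ 1 → s'.arr a = s.arr a := by
  classical
  let diff : ℕ → ℕ → Prop := fun c z =>
    ¬ (s.arr 0 (c / n * n + z) = s.arr 0 (c % n * n + z) ∧
      s.arr 0 (z * n + c / n) = s.arr 0 (z * n + c % n))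
  have hdiff : ∀ y x z : Fin n, diff (y * n + x) z ↔ ¬ ((r y z ↔ r x z) ∧ (r z y ↔ r z x)) := by
    intro y x z
    simp only [diff, index_div, index_mod, hr.2]
    by_cases r y z <;> by_cases r x z <;> by_cases r z y <;> by_cases r z x <;> simp_all
  refine (Run.for (N := n * (n * n)) (fun k s' => s'.var 1 = k ∧ (∀ v, v ≠ 1 → s'.var v = s.var v) ∧
      (∀ a, a ≠ 1 → s'.arr a = s.arr a) ∧
      ∀ c, s'.arr 1 c = if ∃ i < k, i / n = c ∧ diff c (i % n) then 1 else 0)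
      (fun k s' h => ?_) (fun k hk s' h => Run.of_wp ?_) ?_).mono le_rfl ?_
  · simp [twinCond, Exp.eval, Op.eval, h.1, h.2.1, hr.1]
  · obtain ⟨hk1, hv, ha, hc⟩ := h
    have h0 : s'.var 0 = n := (hv 0 (by simp)).trans hr.1
    simp only [twinStep, entry, Prog.wp, Exp.eval, Op.eval, Store.var_setVar, Store.arr_setVar,
      Store.var_setArr, Store.arr_setArr, hk1, h0, ha 0 (by simp)]
    have hlt : ∀ p : Prop, [Decidable p] → (if p then 1 else 0 : ℕ) < 2 ^ W := by
      intro p _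
      have : 1 < 2 ^ W := by
        by_cases hn : n = 0
        · simp [hn] at hk
        · have : 0 < n * (n * n) := by positivity
          omega
      split_ifs <;> omega
    refine ⟨hlt _, by omega, by simp, fun v hv' => by simp [hv', hv], ?_, fun c => ?_⟩
    · intro a ha'
      funext i
      simp [Store.arr_setArr, ha', ha]
    · simp only [true_and]
      have hsplit : (∃ i < k + 1, i / n = c ∧ diff c (i % n)) ↔
          (∃ i < k, i / n = c ∧ diff c (i % n)) ∨ (k / n = c ∧ diff c (k % n)) := by
        constructor
        · rintro ⟨i, hi, h⟩
          rcases Nat.lt_succ_iff_lt_or_eq.1 hi with hi | rfl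
          · exact Or.inl ⟨i, hi, h⟩
          · exact Or.inr h
        · rintro (⟨i, hi, h⟩ | h)
          · exact ⟨i, by omega, h⟩
          · exact ⟨k, by omega, h⟩
      by_cases hck : c = k / n
      · subst hck
        rw [if_pos rfl, hc]
        refine if_congr ?_ rfl rfl
        rw [hsplit]
        simp only [true_and, diff]
        split_ifs <;> simp_all
      · rw [if_neg hck, hc]
        refine if_congr ?_ rfl rfl
        rw [hsplit]
        simp [Ne.symm hck]
  · exact ⟨h1, fun _ _ => rfl, fun _ _ => rfl, fun c => by simp [harr]⟩
  · rintro s' ⟨-, hv, ha, hc⟩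
    refine ⟨⟨(hv 0 (by simp)).trans hr.1, fun y x => by rw [ha 0 (by simp), hr.2]⟩,
      fun y x => ?_, hv, ha⟩
    rw [hc, ← ite_not]
    refine if_congr ?_ rfl rfl
    rw [Twin, ← not_iff_not, not_not, not_forall]
    constructor
    · rintro ⟨i, hi, hiy, hd⟩
      have hn : 0 < n := y.pos
      exact ⟨⟨i % n, Nat.mod_lt _ hn⟩, (hdiff y x ⟨i % n, Nat.mod_lt _ hn⟩).1 hd⟩
    · rintro ⟨z, hz⟩
      refine ⟨(y * n + x) * n + z, triple_lt y x z, ?_, ?_⟩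
      · rw [mul_comm, Nat.mul_add_div y.pos, Nat.div_eq_of_lt z.2, add_zero]
      · rw [Nat.mul_add_mod', Nat.mod_eq_of_lt z.2]
        exact (hdiff y x z).2 hz

theorem run_scan {W : ℕ} {r : Fin n → Fin n → Prop} {s : Store} (hr : HoldsRel r s)
    (ht : HoldsTwins r s) (x : Fin n) (D : Finset (Fin n)) (h1 : s.var 1 = x)
    (h2 : s.var 2 = 0) (h5 : s.var 5 = mask D) (h7 : s.var 7 = if x ∈ D then 1 else 0)
    (h8 : s.var 8 = 0) (h11 : s.var 11 = 1) (hW : 2 * n + 1 < 2 ^ W) (hW' : 2 ^ n < 2 ^ W) :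
    Run W (.loop scanCond scanStep) s ((n + 1) * (scanCond.wt ^ 2 + 1 + scanStep.wt)) fun s' =>
      (s'.var 7 = 0 ↔ x ∈ minimals (chainTwins r) Dᶜ) ∧ s'.var 8 = twinsOutside r D x ∧
        (∀ v ∉ [2, 7, 8, 11, 12], s'.var v = s.var v) ∧ s'.arr = s.arr := by
  classical
  let miss : Fin n → Prop := fun y => y ∉ D ∧ chainTwins r y x
  refine (Run.for (N := n) (fun k s' => s'.var 2 = k ∧ s'.var 11 = 2 ^ k ∧
      s'.var 7 ≤ 2 * k + 1 ∧ (s'.var 7 = 0 ↔ x ∉ D ∧ ∀ y : Fin n, (y : ℕ) < k → ¬ miss y) ∧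
      s'.var 8 = (Finset.univ.filter fun y : Fin n => (y : ℕ) < k ∧ y ∉ D ∧ Twin r x y).card ∧
      (∀ v ∉ [2, 7, 8, 11, 12], s'.var v = s.var v) ∧ s'.arr = s.arr)
      (fun k s' h => ?_) (fun k hk s' h => Run.of_wp ?_) ?_).mono le_rfl ?_
  · have h0 : s'.var 0 = n := (h.2.2.2.2.2.1 0 (by simp)).trans hr.1
    simp [scanCond, Exp.eval, Op.eval, h.1, h0]
  · obtain ⟨hk2, hk11, hle, h7', h8', hv, ha⟩ := h
    have e0 : s'.var 0 = n := (hv 0 (by simp)).trans hr.1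
    have e1 : s'.var 1 = x := (hv 1 (by simp)).trans h1
    have e5 : s'.var 5 = mask D := (hv 5 (by simp)).trans h5
    obtain ⟨y, rfl⟩ : ∃ y : Fin n, (y : ℕ) = k := ⟨⟨k, hk⟩, rfl⟩
    have hpow : 2 ^ (y : ℕ) + 2 ^ (y : ℕ) < 2 ^ W := by
      rw [← two_mul, ← pow_succ']
      exact (Nat.pow_le_pow_right (by simp) y.2).trans_lt hW'
    have hcard : (Finset.univ.filter fun z : Fin n =>
        (z : ℕ) < y + 1 ∧ z ∉ D ∧ Twin r x z).card =
        (Finset.univ.filter fun z : Fin n => (z : ℕ) < y ∧ z ∉ D ∧ Twin r x z).card +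
          if y ∉ D ∧ Twin r x y then 1 else 0 := by
      have : (Finset.univ.filter fun z : Fin n => (z : ℕ) < y + 1 ∧ z ∉ D ∧ Twin r x z) =
          (Finset.univ.filter fun z : Fin n => (z : ℕ) < y ∧ z ∉ D ∧ Twin r x z) ∪
            if y ∉ D ∧ Twin r x y then {y} else ∅ := by
        ext z
        have hz : (z : ℕ) < y + 1 ↔ (z : ℕ) < y ∨ z = y := by
          rw [Nat.lt_succ_iff_lt_or_eq, Fin.ext_iff]
        split_ifs with hy
        · simp only [Finset.mem_filter, Finset.mem_univ, true_and, Finset.mem_union,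
            Finset.mem_singleton, hz]
          constructor
          · rintro ⟨h | h, h'⟩
            exacts [Or.inl ⟨h, h'⟩, Or.inr h]
          · rintro (⟨h, h'⟩ | rfl)
            exacts [⟨Or.inl h, h'⟩, ⟨Or.inr rfl, hy⟩]
        · simp only [Finset.mem_filter, Finset.mem_univ, true_and, Finset.mem_union,
            Finset.notMem_empty, or_false, hz]
          constructor
          · rintro ⟨h | rfl, h'⟩
            exacts [⟨h, h'⟩, absurd h' hy]
          · rintro ⟨h, h'⟩
            exact ⟨Or.inl h, h'⟩
      rw [this, Finset.card_union_of_disjoint]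
      · congr 1
        split_ifs <;> simp
      · rw [Finset.disjoint_left]
        intro z hz
        rw [Finset.mem_filter] at hz
        split_ifs
        · rw [Finset.mem_singleton]
          rintro rfl
          omega
        · simp
    have hmiss : (x ∉ D ∧ ∀ z : Fin n, (z : ℕ) < y + 1 → ¬ miss z) ↔
        (x ∉ D ∧ ∀ z : Fin n, (z : ℕ) < y → ¬ miss z) ∧ ¬ miss y := by
      constructor
      · rintro ⟨h, h'⟩
        exact ⟨⟨h, fun z hz => h' z (by omega)⟩, h' y (by omega)⟩
      · rintro ⟨⟨h, h'⟩, hy⟩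
        refine ⟨h, fun z hz => ?_⟩
        rcases Nat.lt_succ_iff_lt_or_eq.1 hz with hz | hz
        · exact h' z hz
        · rwa [Fin.ext hz]
    have hw : (Finset.univ.filter fun z : Fin n =>
        (z : ℕ) < y ∧ z ∉ D ∧ Twin r x z).card ≤ y := by
      refine (Finset.card_le_card_of_injOn (t := Finset.range y) Fin.val (fun z hz => ?_)
        Fin.val_injective.injOn).trans_eq (Finset.card_range _)
      simpa using (Finset.mem_filter.1 hz).2.1
    have htw : Twin r y x ↔ Twin r x y := ⟨Twin.symm, Twin.symm⟩
    simp only [scanStep, entry, Prog.wp, Exp.eval, Op.eval, Store.var_setVar, Store.arr_setVar,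
      Nat.reduceEqDiff, if_true, if_false, hk2, hk11, e0, e1, e5, ha, hr.2, ht y x,
      mask_div_mod, hcard, hmiss, h8']
    -- the increments of the two counters
    have hA : (1 - if y ∈ D then 1 else 0) * ((if r y x then 1 else 0) +
        (1 - if Twin r y x then 0 else 1) * if (y : ℕ) < x then 1 else 0) ≤ 2 ∧
        ((1 - if y ∈ D then 1 else 0) * ((if r y x then 1 else 0) +
        (1 - if Twin r y x then 0 else 1) * if (y : ℕ) < x then 1 else 0) = 0 ↔ ¬ miss y) := by
      simp only [miss, chainTwins, Fin.lt_def]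
      split_ifs <;> simp_all
    have hB : (1 - if y ∈ D then 1 else 0) * (1 - if Twin r y x then 0 else 1) =
        if y ∉ D ∧ Twin r x y then 1 else 0 := by
      rw [← htw]
      split_ifs <;> simp_all
    have hB' : (if y ∉ D ∧ Twin r x y then 1 else 0) ≤ 1 := by split_ifs <;> simp
    rw [hB]
    have hy := y.2
    refine ⟨?_, by omega, by omega, hpow, by omega, trivial, by rw [pow_succ]; omega, by omega, ?_,
      rfl, ?_, trivial⟩
    · split_ifs <;> omega
    · rw [← h7', ← hA.2]
      omega
    · intro v hv'
      simp only [List.mem_cons, List.not_mem_nil, or_false, not_or] at hv'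
      simp only [hv', if_false]
      exact hv v (by simp [hv'])
  · refine ⟨h2, h11, ?_, ?_, by simp [h8], fun _ _ => rfl, rfl⟩
    · rw [h7]
      split_ifs <;> omega
    · rw [h7]
      split_ifs <;> simp_all
  · rintro s' ⟨-, -, -, h7', h8', hv, ha⟩
    refine ⟨?_, ?_, hv, ha⟩
    · rw [h7', mem_minimals_compl]
      simp only [Fin.is_lt, true_imp_iff, miss, not_and]
    · rw [h8', twinsOutside]
      simp

/-! ### The loop over the elements -/

/-- The arrays `2` and `3` hold a queue of sets and a table of numbers of paths. -/
structure HoldsQueue (s : Store) (t : ℕ) (q : ℕ → Finset (Fin n)) (F : Finset (Fin n) → ℕ) :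
    Prop where
  length : s.var 4 = t
  queue : ∀ i < t, s.arr 2 i = mask (q i)
  table : ∀ S, s.arr 3 (mask S) = F S

open Classical in
/-- The number of ways to continue a path from `D` with an element that is at least `j`; if `D` is
everything, the path itself counts. -/
noncomputable def continuations (r : Fin n → Fin n → Prop) (D : Finset (Fin n)) (j : ℕ) : ℕ :=
  (if D = Finset.univ then 1 else 0) +
    ∑ x ∈ (minimals (chainTwins r) Dᶜ).filter fun x : Fin n => j ≤ (x : ℕ),
      twinsOutside r D x * extCount r (insert x D)ᶜ

theorem continuations_zero {r : Fin n → Fin n → Prop} [Std.Irrefl r] (D : Finset (Fin n)) :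
    continuations r D 0 = extCount r Dᶜ := by
  by_cases hD : D = Finset.univ
  · subst hD
    simp [continuations, minimals, extCount_empty]
  · simp [continuations, hD, extCount_compl_eq_sum hD]

theorem continuations_self (r : Fin n → Fin n → Prop) (D : Finset (Fin n)) :
    continuations r D n = if D = Finset.univ then 1 else 0 := by
  rw [continuations, Finset.sum_eq_zero, add_zero]
  intro x hx
  have := (Finset.mem_filter.1 hx).2
  omega

open Classical in
theorem continuations_succ (r : Fin n → Fin n → Prop) (D : Finset (Fin n)) (x : Fin n) :
    continuations r D x = (if x ∈ minimals (chainTwins r) Dᶜ then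
      twinsOutside r D x * extCount r (insert x D)ᶜ else 0) + continuations r D (x + 1) := by
  have hle : ∀ y : Fin n, (x : ℕ) ≤ y ↔ y = x ∨ (x : ℕ) + 1 ≤ y := by
    intro y
    rw [Fin.ext_iff]
    omega
  rw [continuations, continuations]
  by_cases h : x ∈ minimals (chainTwins r) Dᶜ
  · have : (minimals (chainTwins r) Dᶜ).filter (fun y : Fin n => (x : ℕ) ≤ y) =
        insert x ((minimals (chainTwins r) Dᶜ).filter fun y : Fin n => (x : ℕ) + 1 ≤ y) := by
      ext y
      rw [Finset.mem_filter, hle, Finset.mem_insert, Finset.mem_filter]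
      constructor
      · rintro ⟨h1, h2 | h2⟩
        exacts [Or.inl h2, Or.inr ⟨h1, h2⟩]
      · rintro (rfl | ⟨h1, h2⟩)
        exacts [⟨h, Or.inl rfl⟩, ⟨h1, Or.inr h2⟩]
    rw [if_pos h, this, Finset.sum_insert (by simp)]
    ring
  · have : (minimals (chainTwins r) Dᶜ).filter (fun y : Fin n => (x : ℕ) ≤ y) =
        (minimals (chainTwins r) Dᶜ).filter fun y : Fin n => (x : ℕ) + 1 ≤ y := by
      refine Finset.filter_congr fun y hy => ?_
      rw [hle]
      refine or_iff_right ?_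
      rintro rfl
      exact h hy
    rw [if_neg h, this, zero_add]

/-- The invariant of the loop over the elements: the set `D` is at position `h` of the queue, and
the elements less than `j` have been treated. -/
structure ElementInv (r : Fin n → Fin n → Prop) (h : ℕ) (D : Finset (Fin n)) (f j : ℕ)
    (s : Store) : Prop where
  rel : HoldsRel r s
  twins : HoldsTwins r s
  elt : s.var 1 = j
  head : s.var 3 = h
  set : s.var 5 = mask D
  paths : s.var 6 = f
  pow : s.var 10 = 2 ^ j
  pos : f ≠ 0
  queue : ∃ t q F, HoldsQueue s t q F ∧ IsQueue r h t q F ∧ h < t ∧ q h = D ∧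
    pending r (h + 1) t q F + f * continuations r D j = extCount r Finset.univ

theorem ElementInv.congr {r : Fin n → Fin n → Prop} {h : ℕ} {D : Finset (Fin n)} {f j : ℕ}
    {s s' : Store} (H : ElementInv r h D f j s)
    (hv : ∀ v ∉ [2, 7, 8, 11, 12], s'.var v = s.var v) (ha : s'.arr = s.arr) :
    ElementInv r h D f j s' := by
  obtain ⟨⟨h1, h2⟩, h3, h4, h5, h6, h7, h8, h9, t, q, F, ⟨h10, h11, h12⟩, h13⟩ := H
  refine ⟨⟨(hv 0 (by simp)).trans h1, by rwa [ha]⟩, by rwa [HoldsTwins, ha],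
    (hv 1 (by simp)).trans h4, (hv 3 (by simp)).trans h5, (hv 5 (by simp)).trans h6,
    (hv 6 (by simp)).trans h7, (hv 10 (by simp)).trans h8, h9, t, q, F,
    ⟨(hv 4 (by simp)).trans h10, by rwa [ha], by rwa [ha]⟩, h13⟩

/-- The cost of `elementStep` in the units of `Run`. -/
def elementCost (n : ℕ) : ℕ :=
  scanInit.wt + ((n + 1) * (scanCond.wt ^ 2 + 1 + scanStep.wt) + scanExit.wt)

theorem run_elementStep {W : ℕ} {r : Fin n → Fin n → Prop} [IsStrictOrder (Fin n) r] {h f : ℕ}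
    {D : Finset (Fin n)} {s : Store} (x : Fin n) (H : ElementInv r h D f x s)
    (hW : 2 * n + 1 < 2 ^ W) (hW' : 2 ^ n < 2 ^ W) (hWe : extCount r Finset.univ < 2 ^ W)
    (hWd : (downSets (chainTwins r) Finset.univ).card < 2 ^ W) :
    Run W elementStep s (elementCost n) (ElementInv r h D f (x + 1)) := by
  classical
  refine Run.seq ((Run.of_wp (Q := fun s₁ => s₁.var 2 = 0 ∧ (s₁.var 7 = if x ∈ D then 1 else 0) ∧
    s₁.var 8 = 0 ∧ s₁.var 11 = 1 ∧ (∀ v ∉ [2, 7, 8, 11, 12], s₁.var v = s.var v) ∧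
    s₁.arr = s.arr) ?_).mono le_rfl ?_)
  · simp only [scanInit, Prog.wp, Exp.eval, Op.eval, Store.var_setVar, Store.arr_setVar,
      Nat.reduceEqDiff, if_true, if_false, H.set, H.pow, mask_div_mod]
    refine ⟨by split_ifs <;> omega, by omega, by omega, by omega, trivial, trivial, trivial,
      trivial, fun v hv => ?_, trivial⟩
    simp only [List.mem_cons, List.not_mem_nil, or_false, not_or] at hv
    simp [hv]
  rintro s₁ ⟨h2, h7, h8, h11, hv, ha⟩
  have H₁ := H.congr hv ha
  refine Run.seq ((run_scan H₁.rel H₁.twins x D H₁.elt h2 H₁.set h7 h8 h11 hW hW').mono le_rfl ?_)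
  rintro s₂ ⟨h7', h8', hv', ha'⟩
  obtain ⟨hrel, htw, helt, hhead, hset, hpaths, hpow, hpos, t, q, F, hq, hQ, ht, rfl, hsum⟩ :=
    H₁.congr hv' ha'
  refine Run.of_wp ?_
  have hpow' : 2 ^ (x : ℕ) + 2 ^ (x : ℕ) < 2 ^ W := by
    rw [← two_mul, ← pow_succ']
    exact (Nat.pow_le_pow_right (by simp) x.2).trans_lt hW'
  have hx := x.2
  rw [continuations_succ] at hsum
  refine ⟨fun h0 => ?_, fun h0 => ?_⟩
  · have hm : x ∉ minimals (chainTwins r) (q h)ᶜ := fun hm => h0 (h7'.2 hm)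
    rw [if_neg hm, zero_add] at hsum
    simp only [Prog.wp, Exp.eval, Op.eval, Store.var_setVar, Nat.reduceEqDiff, if_false,
      hpow, helt]
    refine ⟨hpow', by omega, ⟨hrel.1, hrel.2⟩, htw, ?_, hhead, hset, hpaths, ?_, hpos, t, q, F,
      ⟨hq.1, hq.2, hq.3⟩, hQ, ht, rfl, hsum⟩
    · simp [Store.var_setVar]
    · simp [Store.var_setVar, pow_succ, mul_two]
  · have hm := h7'.1 h0
    rw [if_pos hm] at hsum
    have hxq := (mem_minimals_compl.1 hm).1
    have hmask : mask (q h) + 2 ^ (x : ℕ) = mask (insert x (q h)) := (mask_insert hxq).symm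
    have hmW := (mask_lt (insert x (q h))).trans hW'
    have hc : twinsOutside r (q h) x * f ≠ 0 :=
      Nat.mul_ne_zero (twinsOutside_pos hxq).ne' hpos
    have hqt := hq.length
    have hsum' : pending r (h + 1) t q F +
        twinsOutside r (q h) x * f * extCount r (insert x (q h))ᶜ +
          f * continuations r (q h) (x + 1) = extCount r Finset.univ := by
      rw [← hsum]
      ring
    have hinj : ∀ S, mask S = mask (insert x (q h)) ↔ S = insert x (q h) :=
      fun S => (mask_injective n).eq_iff
    have htable := hq.table
    refine ⟨?_, ?_⟩
    · simp only [Exp.eval, Op.eval, hset, hpow, hmask]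
      exact hmW
    refine ⟨fun h1 => ?_, fun h1 => ?_⟩
    · simp only [Exp.eval, Op.eval, Store.var_setVar, Store.arr_setVar, if_true, hset, hpow, hmask,
        htable] at h1
      obtain ⟨hQ', ⟨i, hi, hit, hiE⟩, hp⟩ := hQ.push_found (c := twinsOutside r (q h) x * f) ht hxq h1
      rw [← hp] at hsum'
      have hle := le_pending (r := r) (F := Function.update F (insert x (q h))
        (F (insert x (q h)) + twinsOutside r (q h) x * f)) (q := q) hi hit
      rw [hiE, Function.update_self] at hle
      simp only [Prog.wp, Exp.eval, Op.eval, Store.var_setVar, Store.arr_setVar, Store.var_setArr,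
        Nat.reduceEqDiff, if_true, if_false, hset, hpow, hmask, helt, hpaths, h8', htable]
      refine ⟨by omega, hpow', by omega, ⟨hrel.1, ?_⟩, ?_, ?_, hhead, hset, hpaths, ?_, hpos, t, q, _,
        ⟨hqt, ?_, ?_⟩, hQ', ht, rfl, hsum'⟩
      · simpa [Store.arr_setArr, Store.arr_setVar] using hrel.2
      · simpa [HoldsTwins, Store.arr_setArr, Store.arr_setVar] using htw
      · simp [Store.var_setVar]
      · simp [Store.var_setVar, pow_succ, mul_two]
      · simpa [Store.arr_setArr, Store.arr_setVar] using hq.queue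
      · intro S
        simp [Store.arr_setArr, Store.arr_setVar, Function.update_apply, hinj, htable]
    · simp only [Exp.eval, Op.eval, Store.var_setVar, Store.arr_setVar, if_true, hset, hpow, hmask,
        htable] at h1
      obtain ⟨hQ', hp⟩ := hQ.push_new (c := twinsOutside r (q h) x * f) ht hc hm h1
      rw [← hp] at hsum'
      have hle := le_pending (r := r) (F := Function.update F (insert x (q h))
        (F (insert x (q h)) + twinsOutside r (q h) x * f)) (q := Function.update q t (insert x (q h)))
        (show h + 1 ≤ t by omega) (show t < t + 1 by omega)
      rw [Function.update_self, Function.update_self] at hle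
      have hlen := hQ'.length_le
      have hqh : Function.update q t (insert x (q h)) h = q h := Function.update_of_ne (by omega) _ _
      simp only [Prog.wp, Exp.eval, Op.eval, Store.var_setVar, Store.arr_setVar, Store.var_setArr,
        Store.arr_setArr, Nat.reduceEqDiff, if_true, if_false, hset, hpow, hmask, helt, hpaths, h8',
        hqt, false_and, htable]
      refine ⟨hmW, by omega, by omega, hpow', by omega, ⟨hrel.1, ?_⟩, ?_, ?_, hhead, hset, hpaths, ?_,
        hpos, t + 1, _, _, ⟨?_, ?_, ?_⟩, hQ', by omega, hqh, hsum'⟩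
      · simpa [Store.arr_setArr, Store.arr_setVar] using hrel.2
      · simpa [HoldsTwins, Store.arr_setArr, Store.arr_setVar] using htw
      · simp [Store.var_setVar]
      · simp [Store.var_setVar, pow_succ, mul_two]
      · simp [Store.var_setVar, Store.var_setArr]
      · intro i hi
        by_cases hit : i = t
        · simp [Store.arr_setArr, Store.arr_setVar, hit]
        · simp [Store.arr_setArr, Store.arr_setVar, hit, hq.queue i (by omega)]
      · intro S
        simp [Store.arr_setArr, Store.arr_setVar, Function.update_apply, hinj, htable]

/-! ### The loop over the queue -/

/-- The invariant of the loop over the queue: `k` sets have been processed.  When none is left, the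
set processed last was the whole set, and the variable `6` holds the number of paths to it. -/
structure HeadInv (r : Fin n → Fin n → Prop) (k : ℕ) (s : Store) : Prop where
  rel : HoldsRel r s
  twins : HoldsTwins r s
  head : s.var 3 = k
  queue : ∃ t q F, HoldsQueue s t q F ∧ IsQueue r k t q F ∧
    (k < t ∧ pending r k t q F = extCount r Finset.univ ∨
      k = t ∧ s.var 6 = extCount r Finset.univ)

/-- The cost of `headStep` in the units of `Run`. -/
def headCost (n : ℕ) : ℕ :=
  headInit.wt + ((n + 1) * (elementCond.wt ^ 2 + 1 + elementCost n) +
    (Prog.assign 3 (.bin .add (.var 3) (.lit 1))).wt)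

theorem run_headStep {W : ℕ} {r : Fin n → Fin n → Prop} [IsStrictOrder (Fin n) r] {k : ℕ}
    {s : Store} (H : HeadInv r k s) (hk : s.var 3 < s.var 4)
    (hW : 2 * n + 1 < 2 ^ W) (hW' : 2 ^ n < 2 ^ W) (hWe : extCount r Finset.univ < 2 ^ W)
    (hWd : (downSets (chainTwins r) Finset.univ).card < 2 ^ W) :
    Run W headStep s (headCost n) (HeadInv r (k + 1)) := by
  obtain ⟨hrel, htw, hhead, t, q, F, hq, hQ, hcase⟩ := H
  have hqt := hq.length
  have ht : k < t := by omega
  have hsum : pending r k t q F = extCount r Finset.univ := by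
    rcases hcase with h | h
    · exact h.2
    · omega
  have hF := le_pending (r := r) (F := F) (q := q) le_rfl ht
  have hpos : F (q k) ≠ 0 := (hQ.supp _).2 ⟨k, ht, rfl⟩
  refine Run.seq ((Run.of_wp (Q := ElementInv r k (q k) (F (q k)) 0) ?_).mono le_rfl
    fun s₁ H₁ => ?_)
  · have hmW := (mask_lt (q k)).trans hW'
    simp only [headInit, Prog.wp, Exp.eval, Store.var_setVar, Store.arr_setVar, hhead,
      if_true, hq.queue k ht, hq.table]
    refine ⟨hmW, by omega, by omega, by omega, ⟨hrel.1, hrel.2⟩, htw, ?_, hhead, ?_, ?_, ?_, hpos,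
      t, q, F, ⟨hqt, hq.2, hq.3⟩, hQ, ht, rfl, ?_⟩
    · simp [Store.var_setVar]
    · simp [Store.var_setVar]
    · simp [Store.var_setVar]
    · simp [Store.var_setVar]
    · rw [continuations_zero, ← hsum, pending, pending, Finset.sum_eq_sum_Ico_succ_bot ht, add_comm]
  refine Run.seq ((Run.for (ElementInv r k (q k) (F (q k))) (N := n) (fun j s' h => ?_)
    (fun j hj s' h => run_elementStep ⟨j, hj⟩ h hW hW' hWe hWd) H₁).mono le_rfl fun s₂ H₂ => ?_)
  · simp [elementCond, Exp.eval, Op.eval, h.elt, h.rel.1]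
  obtain ⟨hrel, htw, -, hhead, -, hpaths, -, -, t', q', F', hq', hQ', ht', hqk, hsum'⟩ := H₂
  have hlen := hQ'.length_le
  have hqt' := hq'.length
  refine Run.of_wp ?_
  simp only [Prog.wp, Exp.eval, Op.eval, hhead]
  refine ⟨by omega, ⟨hrel.1, hrel.2⟩, htw, ?_, t', q', F', ⟨hqt', hq'.2, hq'.3⟩, hQ'.succ, ?_⟩
  · simp [Store.var_setVar]
  rw [continuations_self] at hsum'
  split_ifs at hsum' with hu
  · have h1 := hQ'.eq_of_univ ht' (hqk.trans hu)
    refine Or.inr ⟨h1.symm, ?_⟩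
    subst h1
    simpa [pending, Store.var_setVar, hpaths] using hsum'
  · rw [mul_zero, add_zero] at hsum'
    refine Or.inl ⟨?_, hsum'⟩
    by_contra hc
    rw [pending, Finset.Ico_eq_empty_of_le (by omega), Finset.sum_empty] at hsum'
    have := extCount_pos r Finset.univ
    omega

/-- The cost of `countProg` in the units of `Run` if there are at most `C` down-sets. -/
def countCost (n C : ℕ) : ℕ :=
  (n * (n * n) + 1) * (twinCond.wt ^ 2 + 1 + twinStep.wt) + (queueInit.wt +
    ((C + 1) * (headCond.wt ^ 2 + 1 + headCost n) + (Prog.assign 0 (.var 6)).wt))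

theorem run_countProg {W : ℕ} (r : Fin n → Fin n → Prop) [IsStrictOrder (Fin n) r]
    (hW₃ : n * (n * n) < 2 ^ W) (hW : 2 * n + 1 < 2 ^ W) (hW' : 2 ^ n < 2 ^ W)
    (hWe : extCount r Finset.univ < 2 ^ W) :
    Run W countProg (input r) (countCost n (downSets (chainTwins r) Finset.univ).card)
      fun s => s.var 0 = numLinearExtensions r := by
  have hWd : (downSets (chainTwins r) Finset.univ).card < 2 ^ W :=
    (card_downSets_le _ _).trans_lt (by simpa using hW')
  refine Run.seq ((run_twinLoop (holdsRel_input r) (by simp [input]) (by simp [input])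
    hW₃).mono le_rfl ?_)
  rintro s₁ ⟨hrel, htw, hv, ha⟩
  have hv3 : s₁.var 3 = 0 := by simp [hv, input]
  have ha2 : ∀ i, s₁.arr 2 i = 0 := by simp [ha, input]
  have ha3 : ∀ i, s₁.arr 3 i = 0 := by simp [ha, input]
  have hm0 : mask (∅ : Finset (Fin n)) = 0 := by simp [mask]
  refine Run.seq ((Run.of_wp (Q := HeadInv r 0) ?_).mono le_rfl fun s₂ H₂ => ?_)
  · simp only [queueInit, Prog.wp, Exp.eval]
    refine ⟨by omega, by omega, ⟨hrel.1, ?_⟩, ?_, hv3, 1, fun _ => ∅,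
      Function.update (fun _ => 0) ∅ 1, ⟨?_, ?_, ?_⟩, ⟨?_, ?_, ?_, ?_, ?_⟩, Or.inl ⟨by simp, ?_⟩⟩
    · simpa [Store.arr_setArr, Store.arr_setVar] using hrel.2
    · simpa [HoldsTwins, Store.arr_setArr, Store.arr_setVar] using htw
    · simp [Store.var_setVar]
    · simp [Store.arr_setArr, Store.arr_setVar, ha2, hm0]
    · intro S
      have : mask S = 0 ↔ S = ∅ := by rw [← hm0, (mask_injective n).eq_iff]
      simp [Store.arr_setArr, Store.arr_setVar, ha3, Function.update_apply, this]
    · simp [mem_downSets]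
    · intro i hi j hj _
      omega
    · simp
    · simp
    · intro S
      simp [Function.update_apply, eq_comm]
    · simp [pending]
  refine Run.seq ((Run.loop (HeadInv r) (fun k s h h0 => ?_) H₂).mono le_rfl ?_)
  · have hlt : s.var 3 < s.var 4 := by
      by_contra hc
      simp [headCond, Exp.eval, Op.eval, hc] at h0
    refine ⟨?_, run_headStep h hlt hW hW' hWe hWd⟩
    obtain ⟨-, -, hhead, t, q, F, hq, hQ, -⟩ := h
    have := hQ.length_le
    have := hq.length
    omega
  rintro s₃ ⟨k, ⟨-, -, hhead, t, q, F, hq, hQ, hcase⟩, h0⟩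
  have hge : ¬ s₃.var 3 < s₃.var 4 := by
    intro hc
    simp [headCond, Exp.eval, Op.eval, hc] at h0
  have h6 : s₃.var 6 = extCount r Finset.univ := by
    have := hq.length
    rcases hcase with h | h
    · omega
    · exact h.2
  refine Run.of_wp ?_
  simp only [Prog.wp, Exp.eval, h6]
  exact ⟨hWe, by simp [Store.var_setVar, numLinearExtensions_eq_extCount]⟩

/-! ### The running time -/

theorem countCost_mono (n : ℕ) {C C' : ℕ} (h : C ≤ C') : countCost n C ≤ countCost n C' := by
  unfold countCost
  gcongr

theorem exists_countCost_le :
    ∃ K, ∀ n C, 1 ≤ C → countCost n C ≤ K * ((n + 1) ^ 3 * C) := by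
  refine ⟨(twinCond.wt ^ 2 + 1 + twinStep.wt) +
    (queueInit.wt + (Prog.assign 0 (.var 6)).wt) +
    2 * (headCond.wt ^ 2 + 1 + headInit.wt + (Prog.assign 3 (.bin .add (.var 3) (.lit 1))).wt) +
    2 * (elementCond.wt ^ 2 + 1 + scanInit.wt + scanExit.wt) +
    2 * (scanCond.wt ^ 2 + 1 + scanStep.wt), fun n C hC => ?_⟩
  simp only [countCost, headCost, elementCost]
  generalize twinCond.wt ^ 2 + 1 + twinStep.wt = a
  generalize queueInit.wt = b₁
  generalize (Prog.assign 0 (.var 6)).wt = b₂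
  generalize headCond.wt ^ 2 + 1 = c₁
  generalize headInit.wt = c₂
  generalize (Prog.assign 3 (.bin .add (.var 3) (.lit 1))).wt = c₃
  generalize elementCond.wt ^ 2 + 1 = d₁
  generalize scanInit.wt = d₂
  generalize scanExit.wt = d₃
  generalize scanCond.wt ^ 2 + 1 + scanStep.wt = e
  have h1 : n * (n * n) + 1 ≤ (n + 1) ^ 3 * C :=
    (show n * (n * n) + 1 ≤ (n + 1) ^ 3 by nlinarith).trans (Nat.le_mul_of_pos_right _ hC)
  have h2 : ∀ i ≤ 3, (n + 1) ^ i * (C + 1) ≤ 2 * ((n + 1) ^ 3 * C) := by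
    intro i hi
    calc (n + 1) ^ i * (C + 1) ≤ (n + 1) ^ 3 * (2 * C) :=
          Nat.mul_le_mul (Nat.pow_le_pow_right (by omega) hi) (by omega)
      _ = _ := by ring
  calc _ = (n * (n * n) + 1) * a + (b₁ + b₂) + (n + 1) ^ 0 * (C + 1) * (c₁ + c₂ + c₃) +
        (n + 1) ^ 1 * (C + 1) * (d₁ + d₂ + d₃) + (n + 1) ^ 2 * (C + 1) * e := by ring
    _ ≤ (n + 1) ^ 3 * C * a + (n + 1) ^ 3 * C * (b₁ + b₂) +
        2 * ((n + 1) ^ 3 * C) * (c₁ + c₂ + c₃) + 2 * ((n + 1) ^ 3 * C) * (d₁ + d₂ + d₃) +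
          2 * ((n + 1) ^ 3 * C) * e := by
      refine Nat.add_le_add (Nat.add_le_add (Nat.add_le_add (Nat.add_le_add
        (Nat.mul_le_mul_right _ h1) (Nat.le_mul_of_pos_left _ (by positivity)))
        (Nat.mul_le_mul_right _ (h2 0 (by omega)))) (Nat.mul_le_mul_right _ (h2 1 (by omega))))
        (Nat.mul_le_mul_right _ (h2 2 (by omega)))
    _ = _ := by ring

/-- A number of binary digits that suffices for all numbers in a computation. -/
def digits (n : ℕ) : ℕ := n ^ 2 + 3 * n + 9

theorem small_input (r : Fin n → Fin n → Prop) : (input r).Small (digits n) := by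
  refine ⟨fun x => ?_, fun a i => ?_⟩ <;> simp only [input] <;> split_ifs
  · rw [Nat.size_le]
    exact Nat.lt_two_pow_self.trans_le (Nat.pow_le_pow_right (by simp) (by rw [digits]; omega))
  all_goals simp [digits]

/-- The time bound, for a suitable constant `K`. -/
noncomputable def timeBound (K n : ℕ) : ℕ := K * (n + 1) ^ 7 * ⌈(2 * 1.81 ^ n : ℝ)⌉₊

theorem timeBound_isBigO (K : ℕ) :
    (fun n : ℕ => (timeBound K n : ℝ)) =O[atTop] fun n : ℕ => (1.8172 : ℝ) ^ n := by
  have h : (fun n : ℕ => (timeBound K n : ℝ)) =O[atTop] fun n : ℕ => (n : ℝ) ^ 7 * 1.81 ^ n := by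
    refine IsBigO.of_bound (K * 2 ^ 7 * 3) ?_
    filter_upwards [eventually_ge_atTop 1] with n hn
    have hn' : (1 : ℝ) ≤ n := by exact_mod_cast hn
    have h1 : (⌈(2 * 1.81 ^ n : ℝ)⌉₊ : ℝ) ≤ 3 * 1.81 ^ n := by
      have := (Nat.ceil_lt_add_one (show (0 : ℝ) ≤ 2 * 1.81 ^ n by positivity)).le
      have h2 : (1 : ℝ) ≤ 1.81 ^ n := one_le_pow₀ (by norm_num)
      linarith
    rw [Real.norm_of_nonneg (by positivity), Real.norm_of_nonneg (by positivity), timeBound]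
    push_cast
    calc (K * (n + 1) ^ 7 * ⌈(2 * 1.81 ^ n : ℝ)⌉₊ : ℝ) ≤ K * (2 * n) ^ 7 * (3 * 1.81 ^ n) := by
          gcongr
          linarith
      _ = _ := by ring
  refine h.trans (IsLittleO.isBigO ?_)
  exact isLittleO_pow_const_mul_const_pow_const_pow_of_norm_lt 7 (by norm_num)

theorem exists_timeBound : ∃ K, ∀ (n : ℕ) (r : Fin n → Fin n → Prop), IsStrictOrder (Fin n) r →
    posetDim r ≤ 2 → ∃ (t : ℕ) (s : Store), Exec countProg (input r) t s ∧
      s.var 0 = numLinearExtensions r ∧ t ≤ timeBound K n := by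
  obtain ⟨K, hK⟩ := exists_countCost_le
  refine ⟨K * 100, fun n r hr hdim => ?_⟩
  have hpow : ∀ k < digits n, 2 ^ k < 2 ^ digits n := fun k hk =>
    Nat.pow_lt_pow_right (by simp) hk
  have hn : n < 2 ^ n := Nat.lt_two_pow_self
  have h3 : n * (n * n) < 2 ^ digits n := by
    refine lt_of_le_of_lt ?_ (hpow (n + (n + n)) (by rw [digits]; omega))
    rw [pow_add, pow_add]
    gcongr
  have h1 : 2 * n + 1 < 2 ^ digits n := by
    refine lt_of_le_of_lt ?_ (hpow (n + 1) (by rw [digits]; omega))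
    rw [pow_succ]
    omega
  obtain ⟨t, s, h4, h5, -, h6⟩ := run_countProg r h3 h1 (hpow n (by rw [digits]; omega))
    ((extCount_le r _).trans_lt (hpow _ (by rw [digits, Fintype.card_fin]; omega))) (small_input r)
  refine ⟨t, s, h4, h6, h5.trans ?_⟩
  have hC : (downSets (chainTwins r) Finset.univ).card ≤ ⌈(2 * 1.81 ^ n : ℝ)⌉₊ := by
    have h := card_downSets_chainTwins_le hdim
    rw [Fintype.card_fin] at h
    exact_mod_cast h.trans (Nat.le_ceil _)
  have hC1 : 1 ≤ ⌈(2 * 1.81 ^ n : ℝ)⌉₊ := Nat.one_le_ceil_iff.2 (by positivity)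
  calc countCost n (downSets (chainTwins r) Finset.univ).card * (1 + digits n) ^ 2
      ≤ K * ((n + 1) ^ 3 * ⌈(2 * 1.81 ^ n : ℝ)⌉₊) * (10 * (n + 1) ^ 2) ^ 2 := by
        refine Nat.mul_le_mul ((countCost_mono n hC).trans (hK n _ hC1)) (Nat.pow_le_pow_left ?_ 2)
        rw [digits]
        nlinarith
    _ = timeBound (K * 100) n := by
        rw [timeBound]
        ring

end RAM

/-- There is a random access machine program that computes the number of linear extensions of
every two-dimensional poset on `n` elements (left in the variable `0`) in time `O(1.8172 ^ n)`. -/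
theorem theorem1 :
    ∃ (p : RAM.Prog) (T : ℕ → ℕ),
      ((fun n : ℕ => (T n : ℝ)) =O[atTop] fun n : ℕ => (1.8172 : ℝ) ^ n) ∧
      ∀ (n : ℕ) (r : Fin n → Fin n → Prop), IsStrictOrder (Fin n) r → posetDim r ≤ 2 →
        ∃ (t : ℕ) (s : RAM.Store), RAM.Exec p (RAM.input r) t s ∧
          s.var 0 = numLinearExtensions r ∧ t ≤ T n := by
  obtain ⟨K, hK⟩ := RAM.exists_timeBound
  exact ⟨RAM.countProg, RAM.timeBound K, RAM.timeBound_isBigO K, hK⟩
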